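/- Fix a field $\mathbb F$. Order $\mathbb R^2$ by $u\preceq v$ iff $u_1\le v_1$ and $u_2\le v_2$. A *2-parameter persistence module* $M$ consists of $\mathbb F$-vector spaces $M_u$ ($u\in\mathbb R^2$) and linear maps $i_M(u,v)\colon M_u\to M_v$ for $u\preceq v$ with $i_M(u,u)=\mathrm{id}$ and $i_M(v,w)\circ i_M(u,v)=i_M(u,w)$; it is *trivial* if all $M_u=0$. All modules below are assumed to have finite-dimensional $M_u$ for every $u$ (as holds for finitely presented modules). *Matching distance.* Every line $L\subset\mathbb R^2$ of positive slope is written uniquely as $u=s\,\vec m+b$ with $m_1,m_2>0$, $\max(m_1,m_2)=1$, $b_1+b_2=0$; put $\hat m^L=\min(m_1,m_2)$, and let $M^L$ be the 1-parameter module $s\mapsto M_{s\vec m+b}$. If a 1-parameter module is isomorphic to a finite direct sum of interval modules $I[b_j,d_j)$ with $b_j<d_j\le\infty$, its persistence diagram $\mathrm{dgm}$ is the finite multiset of the points $(b_j,d_j)$. The bottleneck distance $d_B$ of two diagrams is the minimum, over all matchings (multi-bijections between a multi-subset of one and a multi-subset of the other), of the largest among the $\ell^\infty$-distances of matched points (with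 $\infty-\infty=0$, $\infty-a=\infty$) and the $\ell^\infty$-distances $(d-b)/2$ of unmatched points $(b,d)$ to the diagonal. The matching distance is $$d_{match}(M,N)=\sup_L \hat m^L\, d_B(\mathrm{dgm}\,M^L,\mathrm{dgm}\,N^L)\in[0,\infty],$$ the supremum over all lines $L$ of positive slope. *Property (P) for $M$ with a finite set $C_M\subset\mathbb R^2$.* Let $\overline{C}_M$ be the closure of $C_M$ under least upper bounds (of nonempty finite subsets). For all $u\preceq v$: if $\{c\in\overline C_M: c\preceq u\}$ is nonempty, then $\operatorname{rank} i_M(u,v)=\operatorname{rank} i_M(\bar u,\bar v)$ where $\bar u=\max\{c\in\overline C_M: c\preceq u\}$ and $\bar v=\max\{c\in\overline C_M: c\preceq v\}$; otherwise $\operatorname{rank} i_M(u,v)=0$. *Reciprocal position.* Let $\mathbb P^2=\mathbb R^2\cup\ell_\infty$ be the projective plane, where $\ell_\infty$ consists of the points $[0:x_1:x_2]$; a line of positive slope with direction $\vec m$ is completed by the point $[0:m_1:m_2]$. For nonempty $A\subseteq\{1,2\}$ and $u\in\mathbb R^2$ let $S_A(u)=\{x\in\mathbb R^2: x_i=u_i\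 (i\in A),\ x_i>u_i\ (i\notin A)\}$; for $p=[0:v_1:v_2]$ with $v_1,v_2>0$ let $S_A(p)=\{[0:x_1:x_2]: x_i=v_i\ (i\in A),\ x_i>v_i\ (i\notin A)\}$. For each such point $p$ and each line $L$ of positive slope there is exactly one nonempty $A=A^L_p$ such that $L$ meets $S_A(p)$. For $U\subseteq\mathbb P^2$ write $L\sim_U L'$ if $A^L_p=A^{L'}_p$ for all $p\in U$; points of $\ell_\infty$ with no representative $[0:v_1:v_2]$, $v_1,v_2>0$, impose no condition. For $u\in\mathbb R^2$ let $p_L(u)$ be the parameter $s$ for which $s\vec m+b$ is the unique point of $L$ on the boundary of the cone $\{x: u\preceq x\}$. *Property (Q) for $M,N$ (with $C_M$, $C_N$) with a finite set $\Omega\subset\mathbb P^2$.* For all $u,v,w,x\in\overline C_M\cup\overline C_N$ and $\delta,\eta\in\{1,2\}$, not necessarily distinct, the sign (positive, negative or zero) of $$\frac{|p_L(u)-p_L(v)|}{\delta}-\frac{|p_L(w)-p_L(x)|}{\eta}$$ is the same for any two lines of positive slope that are equivalent under $\sim_{\overline C_M\cup\overline C_N\cup\Omega}$. **Theorem.** Let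 $M,N$ be 2-parameter persistence modules as above. If $M$ and $N$ are both trivial, then $d_{match}(M,N)=0$. Otherwise, whenever $M$ and $N$ satisfy (P) with finite sets $C_M$ and $C_N$, and $M,N$ satisfy (Q) with a finite set $\Omega$, the matching distance is attained on a line through two points of $\overline C_M\cup\overline C_N\cup\overline\Omega$, where $\overline\Omega=\Omega\cup\{[0:1:1]\}$: there is a line $L$ of positive slope whose projective completion contains two distinct points of $\overline C_M\cup\overline C_N\cup\overline\Omega$ (the choice of the two points need not be unique) and for which $$\hat m^L\, d_B(\mathrm{dgm}\,M^L,\mathrm{dgm}\,N^L)=d_{match}(M,N).$$ -/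

import Mathlib

universe u v w

open scoped ENNReal LinearAlgebra.Projectivization

noncomputable section

/-- A persistence module over a field `F` indexed by a preordered set `P` of parameters. -/
structure PersistenceModule (F : Type u) [Field F] (P : Type*) [Preorder P] where
  obj : P → Type v
  [addCommGroup : ∀ s, AddCommGroup (obj s)]
  [module : ∀ s, Module F (obj s)]
  map : ∀ {s t : P}, s ≤ t → (obj s →ₗ[F] obj t)
  map_refl : ∀ s : P, map (le_refl s) = LinearMap.id
  map_comp : ∀ {r s t : P} (hrs : r ≤ s) (hst : s ≤ t),
    (map hst).comp (map hrs) = map (hrs.trans hst)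

attribute [instance] PersistenceModule.addCommGroup PersistenceModule.module

namespace PersistenceModule

variable {F : Type u} [Field F] {P : Type*} [Preorder P]

/-- All vector spaces of the module vanish. -/
def IsTrivial (M : PersistenceModule.{u, v} F P) : Prop := ∀ s, Subsingleton (M.obj s)

/-- All vector spaces of the module are finite-dimensional. -/
def PointwiseFinite (M : PersistenceModule.{u, v} F P) : Prop :=
  ∀ s, FiniteDimensional F (M.obj s)

/-- Isomorphism of persistence modules: linear isomorphisms commuting with the transition maps. -/
def Isomorphic (M : PersistenceModule.{u, v} F P) (N : PersistenceModule.{u, w} F P) : Prop :=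
  ∃ e : ∀ s, M.obj s ≃ₗ[F] N.obj s,
    ∀ (s t : P) (h : s ≤ t) (x : M.obj s), e t (M.map h x) = N.map h (e s x)

/-- The direct sum of a finite family of persistence modules. -/
def directSum {ι : Type} [Fintype ι] (M : ι → PersistenceModule.{u, v} F P) :
    PersistenceModule.{u, v} F P where
  obj s := ∀ i, (M i).obj s
  map h := LinearMap.piMap fun i => (M i).map h
  map_refl s := by
    ext x i
    simp [LinearMap.coe_piMap, Pi.map_apply, (M i).map_refl]
  map_comp hrs hst := by
    ext x i
    simp [LinearMap.coe_piMap, Pi.map_apply, ← (M i).map_comp hrs hst]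

end PersistenceModule

/-! ### One-parameter modules: intervals, diagrams, bottleneck distance -/

/-- A half-open interval `[birth, death)` with `birth < death ≤ ∞`, equivalently a point above the
diagonal of a persistence diagram. -/
structure Bar where
  birth : ℝ
  death : WithTop ℝ
  lt : (birth : WithTop ℝ) < death

/-- `s ∈ [birth, death)`. -/
def Bar.Contains (I : Bar) (s : ℝ) : Prop := I.birth ≤ s ∧ (s : WithTop ℝ) < I.death

open Classical in
theorem Bar.eq_zero_of_not_contains {F : Type u} [Field F] {I : Bar} {s : ℝ} (hs : ¬ I.Contains s)
    {x : F} (hx : x ∈ (if I.Contains s then ⊤ else ⊥ : Submodule F F)) : x = 0 := by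
  rwa [if_neg hs, Submodule.mem_bot] at hx

open Classical in
/-- The interval module of `[birth, death)`: it is `F` (as the submodule `⊤` of `F`) on the
interval, `0` elsewhere, and its transition maps are identities inside the interval. -/
def Bar.intervalModule (F : Type u) [Field F] (I : Bar) : PersistenceModule.{u, u} F ℝ where
  obj s := ((if I.Contains s then ⊤ else ⊥ : Submodule F F) : Submodule F F)
  map {s t} _ := if ht : I.Contains t then
      (Submodule.subtype _).codRestrict _ (fun x => by rw [if_pos ht]; trivial)
    else 0
  map_refl s := by
    by_cases hs : I.Contains s
    · rw [dif_pos hs]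
      ext x
      rfl
    · rw [dif_neg hs]
      ext x
      exact (Bar.eq_zero_of_not_contains hs x.2).symm
  map_comp {r s t} hrs hst := by
    by_cases ht : I.Contains t
    · rw [dif_pos ht, dif_pos ht]
      by_cases hs : I.Contains s
      · rw [dif_pos hs]
        ext x
        rfl
      · rw [dif_neg hs]
        have hr : ¬ I.Contains r := fun hr =>
          hs ⟨hr.1.trans hrs, (WithTop.coe_le_coe.2 hst).trans_lt ht.2⟩
        ext x
        exact (Bar.eq_zero_of_not_contains hr x.2).symm
    · rw [dif_neg ht, dif_neg ht, LinearMap.zero_comp]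

/-- `D` is a persistence diagram of `V`: `V` is isomorphic to the direct sum of the interval
modules of the points of the finite multiset `D`. -/
def IsDiagramOf {F : Type u} [Field F] (V : PersistenceModule.{u, v} F ℝ) (D : Multiset Bar) :
    Prop :=
  ∃ (n : ℕ) (I : Fin n → Bar), D = Finset.univ.val.map I ∧
    V.Isomorphic (PersistenceModule.directSum fun j => (I j).intervalModule F)

open Classical in
/-- The persistence diagram of a one-parameter module (with the empty diagram as a default value
if there is no decomposition into finitely many interval modules). -/
def dgm {F : Type u} [Field F] (V : PersistenceModule.{u, v} F ℝ) : Multiset Bar :=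
  if h : ∃ D, IsDiagramOf V D then h.choose else 0

/-- `|a - b|` on `ℝ ∪ {∞}`, with `∞ - ∞ = 0` and `∞ - a = ∞` for real `a`. -/
def extAbsDiff : WithTop ℝ → WithTop ℝ → ℝ≥0∞
  | some a, some b => ENNReal.ofReal |a - b|
  | some _, none => ⊤
  | none, some _ => ⊤
  | none, none => 0

/-- The `ℓ^∞` distance of two points of diagrams: the cost of matching them. -/
def Bar.dist (I J : Bar) : ℝ≥0∞ :=
  max (ENNReal.ofReal |I.birth - J.birth|) (extAbsDiff I.death J.death)

/-- The `ℓ^∞` distance to the diagonal: the cost of leaving a point unmatched. -/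
def Bar.diagDist (I : Bar) : ℝ≥0∞ := extAbsDiff I.death I.birth / 2

/-- A matching of two multisets: a multi-bijection (the multiset `pairs`) between a multi-subset of
`D` and a multi-subset of `E`; `left` and `right` are the unmatched points. -/
structure BarMatching (D E : Multiset Bar) where
  pairs : Multiset (Bar × Bar)
  left : Multiset Bar
  right : Multiset Bar
  left_eq : pairs.map Prod.fst + left = D
  right_eq : pairs.map Prod.snd + right = E

/-- The greatest cost of a matched pair or of an unmatched point (`0` if there is none). -/
def BarMatching.cost {D E : Multiset Bar} (σ : BarMatching D E) : ℝ≥0∞ :=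
  max (σ.pairs.map fun x => x.1.dist x.2).sup ((σ.left + σ.right).map Bar.diagDist).sup

/-- The bottleneck distance (a minimum, as there are finitely many matchings). -/
def bottleneckDist (D E : Multiset Bar) : ℝ≥0∞ := ⨅ σ : BarMatching D E, σ.cost

/-! ### Lines of positive slope and the matching distance -/

/-- A line `s ↦ s • m + b` of positive slope in the plane, in its standard normalisation
`max (m 0) (m 1) = 1`, `b 0 + b 1 = 0`; every line of positive slope is given by exactly one
such pair `(m, b)`. -/
structure PosLine where
  m : Fin 2 → ℝ
  b : Fin 2 → ℝ
  m_pos : ∀ i, 0 < m i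
  m_max : max (m 0) (m 1) = 1
  b_sum : b 0 + b 1 = 0

namespace PosLine

/-- The point of the line with parameter `s`. -/
def point (L : PosLine) (s : ℝ) : Fin 2 → ℝ := s • L.m + L.b

theorem point_mono (L : PosLine) : Monotone L.point := fun s t h i => by
  have := mul_le_mul_of_nonneg_right h (L.m_pos i).le
  simpa [point] using this

/-- The minimal coordinate of the direction vector. -/
def weight (L : PosLine) : ℝ := min (L.m 0) (L.m 1)

/-- The parameter `p_L(u)` of the push of `u` onto the line. -/
def pushParam (L : PosLine) (u : Fin 2 → ℝ) : ℝ :=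
  max ((u 0 - L.b 0) / L.m 0) ((u 1 - L.b 1) / L.m 1)

theorem le_point_iff (L : PosLine) (u : Fin 2 → ℝ) (s : ℝ) :
    u ≤ L.point s ↔ L.pushParam u ≤ s := by
  simp only [Pi.le_def, Fin.forall_fin_two, point, pushParam, max_le_iff, Pi.add_apply,
    Pi.smul_apply, smul_eq_mul, div_le_iff₀ (L.m_pos _), sub_le_iff_le_add]

/-- The push of `u` is the unique point of the line on the boundary of the positive cone of `u`. -/
theorem point_mem_frontier_iff (L : PosLine) (u : Fin 2 → ℝ) (s : ℝ) :
    L.point s ∈ frontier (Set.Ici u) ↔ s = L.pushParam u := by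
  have hI : interior (Set.Ici u) = Set.univ.pi fun i => Set.Ioi (u i) := by
    rw [← Set.pi_univ_Ici, interior_pi_set Set.finite_univ]
    simp
  rw [isClosed_Ici.frontier_eq, hI, Set.mem_sdiff, Set.mem_Ici, le_point_iff]
  have h2 : L.point s ∈ (Set.univ.pi fun i => Set.Ioi (u i)) ↔ L.pushParam u < s := by
    simp only [Set.mem_pi, Set.mem_univ, true_imp_iff, Set.mem_Ioi, Fin.forall_fin_two, point,
      pushParam, max_lt_iff, Pi.add_apply, Pi.smul_apply, smul_eq_mul, div_lt_iff₀ (L.m_pos _),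
      sub_lt_iff_lt_add]
  rw [h2, not_lt]
  exact ⟨fun h => le_antisymm h.2 h.1, fun h => ⟨h.ge, h.le⟩⟩

end PosLine

/-- The restriction of a two-parameter persistence module to a line of positive slope. -/
def PersistenceModule.restrict {F : Type u} [Field F]
    (M : PersistenceModule.{u, v} F (Fin 2 → ℝ)) (L : PosLine) : PersistenceModule.{u, v} F ℝ where
  obj s := M.obj (L.point s)
  map h := M.map (L.point_mono h)
  map_refl _ := M.map_refl _
  map_comp _ _ := M.map_comp _ _

/-- The weighted bottleneck distance of `M` and `N` along the line `L`. -/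
def weightedBottleneck {F : Type u} [Field F] (M : PersistenceModule.{u, v} F (Fin 2 → ℝ))
    (N : PersistenceModule.{u, w} F (Fin 2 → ℝ)) (L : PosLine) : ℝ≥0∞ :=
  ENNReal.ofReal L.weight * bottleneckDist (dgm (M.restrict L)) (dgm (N.restrict L))

/-- The matching distance. -/
def matchingDist {F : Type u} [Field F] (M : PersistenceModule.{u, v} F (Fin 2 → ℝ))
    (N : PersistenceModule.{u, w} F (Fin 2 → ℝ)) : ℝ≥0∞ :=
  ⨆ L : PosLine, weightedBottleneck M N L

/-! ### Critical values -/

/-- Property (P) for `M` with the set `C`: `C` is a finite set whose closure `supClosure C` under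
least upper bounds determines the ranks of the transition maps of `M`. -/
def IsCriticalSet {F : Type u} [Field F] (M : PersistenceModule.{u, v} F (Fin 2 → ℝ))
    (C : Set (Fin 2 → ℝ)) : Prop :=
  C.Finite ∧ ∀ (u v : Fin 2 → ℝ) (huv : u ≤ v),
    (∀ (u' v' : Fin 2 → ℝ) (h' : u' ≤ v'),
      IsGreatest {c | c ∈ supClosure C ∧ c ≤ u} u' →
      IsGreatest {c | c ∈ supClosure C ∧ c ≤ v} v' →
        (M.map huv).rank = (M.map h').rank) ∧
    ({c | c ∈ supClosure C ∧ c ≤ u} = ∅ → (M.map huv).rank = 0)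

/-! ### The projective plane, reciprocal positions and switch points -/

/-- The real projective plane, with homogeneous coordinates `[x 0 : x 1 : x 2]`. -/
abbrev ProjPlane : Type := ℙ ℝ (Fin 3 → ℝ)

/-- The proper point `[1 : u 0 : u 1]`. -/
def properPoint (u : Fin 2 → ℝ) : ProjPlane :=
  Projectivization.mk ℝ ![1, u 0, u 1] fun h => one_ne_zero (congrFun h 0)

/-- The point at infinity `[0 : v 0 : v 1]` of a positive direction `v`. -/
def pointAtInfinity (v : Fin 2 → ℝ) (hv : ∀ i, 0 < v i) : ProjPlane :=
  Projectivization.mk ℝ ![0, v 0, v 1] fun h => (hv 0).ne' (congrFun h 1)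

/-- The point `[0 : 1 : 1]`. -/
def diagonalPoint : ProjPlane := pointAtInfinity (fun _ => 1) fun _ => one_pos

/-- The points of the projective completion of a line of positive slope. -/
def PosLine.projPoints (L : PosLine) : Set ProjPlane :=
  insert (pointAtInfinity L.m L.m_pos) (Set.range fun s => properPoint (L.point s))

/-- The points `x ≥ u` whose coordinates agree with those of `u` exactly at the indices in `A`.
For nonempty `A` this is an open face of the boundary of the positive cone of `u`. -/
def coneFace (A : Set (Fin 2)) (u : Fin 2 → ℝ) : Set (Fin 2 → ℝ) :=
  {x | (∀ i ∈ A, x i = u i) ∧ ∀ i ∉ A, u i < x i}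

/-- The set `S_A(p)` for a point `p` of the projective plane: for proper `p` it is `coneFace A p`;
for `p = [0 : v 0 : v 1]` with `v` positive it is the set of all `[0 : x 0 : x 1]` with `x` in
`coneFace A v`. For the other points at infinity, which lie on no line of positive slope, it is
empty, so that they do not distinguish lines. -/
def projFace (A : Set (Fin 2)) (p : ProjPlane) : Set ProjPlane :=
  {q | (∃ u x : Fin 2 → ℝ, p = properPoint u ∧ x ∈ coneFace A u ∧ q = properPoint x) ∨
    ∃ (v x : Fin 2 → ℝ) (hv : ∀ i, 0 < v i) (hx : ∀ i, 0 < x i),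
      p = pointAtInfinity v hv ∧ x ∈ coneFace A v ∧ q = pointAtInfinity x hx}

/-- The reciprocal position of `p` and `L`: the set of the nonempty `A` such that `L` meets
`S_A(p)`. There is exactly one such `A` if `p` is proper or has positive direction. -/
def PosLine.position (L : PosLine) (p : ProjPlane) : Set (Set (Fin 2)) :=
  {A | A.Nonempty ∧ (L.projPoints ∩ projFace A p).Nonempty}

/-- The relation `L ∼_U L'`: same reciprocal position with respect to all points of `U`. -/
def LineEquiv (U : Set ProjPlane) (L L' : PosLine) : Prop :=
  ∀ p ∈ U, L.position p = L'.position p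

/-- The difference `|p_L(u) - p_L(v)| / δ - |p_L(w) - p_L(x)| / η`. -/
def costDiff (L : PosLine) (u v w x : Fin 2 → ℝ) (δ η : ℝ) : ℝ :=
  |L.pushParam u - L.pushParam v| / δ - |L.pushParam w - L.pushParam x| / η

/-- Property (Q) for the set `C` (the union of the closures of the sets of critical values of two
modules) with the set `Ω` of switch points. -/
def IsSwitchSet (C : Set (Fin 2 → ℝ)) (Ω : Set ProjPlane) : Prop :=
  Ω.Finite ∧ ∀ L L' : PosLine, LineEquiv (properPoint '' C ∪ Ω) L L' →
    ∀ u ∈ C, ∀ v ∈ C, ∀ w ∈ C, ∀ x ∈ C,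
      ∀ δ ∈ ({1, 2} : Set ℝ), ∀ η ∈ ({1, 2} : Set ℝ),
        SignType.sign (costDiff L u v w x δ η) = SignType.sign (costDiff L' u v w x δ η)

end

/-!
Why the maximum is attained on a line through two special points.

**Rescaling.** Over the coordinate `i` in which its direction is `1`, a line is the graph of
`t ↦ μ t + c` with `0 < μ ≤ 1`, where `μ` is its weight. Up to a translation, the weighted push
parameter of `u` is `max (μ u_i + c) u_{1-i}` (`PosLine.graphHom_eq`). It is a sup-homomorphism
`h : ℝ² → ℝ` that is piecewise affine in `(μ, c)` and still makes sense for `μ = 0`, so all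
bottleneck distances are treated as functions `fiberDist` of a sup-homomorphism.

**Diagrams.** Let `h₀` be a sup-homomorphism. The critical values that are greatest in their
sublevel set for `h₀` form a finite chain. The module on this chain decomposes into bars
(`exists_isBarBasis`), and this one decomposition yields the diagrams for all `h` that weakly
respect the order given by `h₀`: apply `h` to the ends of the bars and drop the bars that become
empty (`IsCriticalSet.exists_symbolic_barcode`). That `dgm` is this diagram needs the uniqueness of
interval decompositions, which follows from counting bars by ranks (`IsDiagramOf.unique`). Keeping
the empty bars does not change the bottleneck distance (`bottleneckDist_realize`).

**Edges.** Along a segment of lines with constant reciprocal positions, property (Q) fixes the order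
of all the costs `|h u - h v| / δ`, and by continuity this order persists weakly at the ends. The
costs, as functions on the closed segment, form a finite chain, hence so do their finite maxima and
minima, and the bottleneck distance is a single one of them (`symBottleneck_mem_costFunctions`).
It is the absolute value of an affine function, so it is bounded by its values at the ends of the
segment (`fiberDist_le_max`).

**Moving lines.** A line can be translated until it meets a proper point of `C ∪ Ω`
(`exists_translate`) and then rotated about that point until it meets a second point
(`exists_rotate`), in each case without decreasing the weighted bottleneck distance. If the slope
tends to zero during the rotation, the limit is given by `max c u_{1-i}`, a clamped version of the
push `u_{1-i}` of a line of slope one below all the points; clamping cannot increase the distance.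
The lines that arise in the end are finitely many, so one of them attains the supremum.
-/

noncomputable section

open PersistenceModule

/-! ### Bar bases of persistence modules -/

namespace PersistenceModule

variable {F : Type u} [Field F] {P : Type*} [Preorder P]

/-- The pullback of a persistence module along a monotone map of parameters. -/
def comap {Q : Type*} [Preorder Q] (M : PersistenceModule.{u, v} F Q) (f : P → Q)
    (hf : Monotone f) : PersistenceModule.{u, v} F P where
  obj p := M.obj (f p)
  map h := M.map (hf h)
  map_refl _ := M.map_refl _
  map_comp _ _ := M.map_comp _ _

theorem map_refl_apply (V : PersistenceModule.{u, v} F P) {p : P} (h : p ≤ p) (x : V.obj p) :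
    V.map h x = x := by
  rw [V.map_refl]; rfl

theorem map_map (V : PersistenceModule.{u, v} F P) {p q r : P} (h : p ≤ q) (h' : q ≤ r)
    (x : V.obj p) : V.map h' (V.map h x) = V.map (h.trans h') x := by
  rw [← V.map_comp h h']; rfl

/-- A finite family `e` of sections is a bar basis, with supports `S`, of a family `K` of subspaces
of `V`: at every parameter `p` the vectors `e i p` with `p ∈ S i` form a basis of `K p`, the others
vanish, and each section is carried along by the transition maps once it is born. -/
structure IsBarBasis (V : PersistenceModule.{u, v} F P) (K : ∀ p, Submodule F (V.obj p))
    {ι : Type} [Fintype ι] (S : ι → Set P) (e : ι → ∀ p, V.obj p) : Prop where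
  mem : ∀ i p, e i p ∈ K p
  eq_zero : ∀ i p, p ∉ S i → e i p = 0
  indep : ∀ p (a : ι → F), (∀ i, p ∉ S i → a i = 0) → ∑ i, a i • e i p = 0 → a = 0
  span : ∀ p, ∀ x ∈ K p, ∃ a : ι → F, (∀ i, p ∉ S i → a i = 0) ∧ ∑ i, a i • e i p = x
  map_eq : ∀ i p q (h : p ≤ q), p ∈ S i → V.map h (e i p) = e i q

end PersistenceModule


/-- A bar basis of a persistence module over a finite chain exists. If `v` is a nonzero vector at
the first parameter where `K` does not vanish, `j` the last parameter at which `v` survives and `φ`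
a functional with `φ v = 1` there, then pulling `φ` back gives a retraction of `K` onto the bar
spanned by `v`; its kernel has smaller total dimension. -/
theorem exists_isBarBasis {F : Type u} [Field F] {P : Type*} [LinearOrder P] [Fintype P]
    (V : PersistenceModule.{u, v} F P) (hV : V.PointwiseFinite) (n : ℕ) :
    ∀ K : (∀ p, Submodule F (V.obj p)),
      (∀ p q (h : p ≤ q), ∀ x ∈ K p, V.map h x ∈ K q) →
      ∑ p, Module.finrank F (K p) = n →
      ∃ (m : ℕ) (b : Fin m → P) (d : Fin m → WithTop P) (e : Fin m → ∀ p, V.obj p),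
        (∀ i, (b i : WithTop P) < d i) ∧
        V.IsBarBasis K (fun i => {p | b i ≤ p ∧ (p : WithTop P) < d i}) e := by
  induction n using Nat.strong_induction_on with
  | _ n ih =>
  intro K hK hn
  have hfin : ∀ p, FiniteDimensional F (V.obj p) := hV
  by_cases h0 : ∀ p, K p = ⊥
  · refine ⟨0, Fin.elim0, Fin.elim0, fun i => i.elim0, fun i => i.elim0, ?_⟩
    refine ⟨fun i => i.elim0, fun i => i.elim0, fun p a _ _ => funext fun i => i.elim0, ?_,
      fun i => i.elim0⟩
    intro p x hx
    rw [h0 p, Submodule.mem_bot] at hx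
    exact ⟨0, fun i => i.elim0, by simp [hx]⟩
  push Not at h0
  classical
  obtain ⟨p₀, hp₀, hmin⟩ := Finset.exists_min_image (Finset.univ.filter fun p => K p ≠ ⊥) id
    (by obtain ⟨p, hp⟩ := h0; exact ⟨p, by simpa using hp⟩)
  simp only [Finset.mem_filter, Finset.mem_univ, true_and, id] at hp₀ hmin
  obtain ⟨v, hvK, hv⟩ := Submodule.exists_mem_ne_zero_of_ne_bot hp₀
  obtain ⟨j, ⟨hpj, hvj⟩, hjmax⟩ : ∃ j, (∃ h : p₀ ≤ j, V.map h v ≠ 0) ∧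
      ∀ q, (∃ h : p₀ ≤ q, V.map h v ≠ 0) → q ≤ j := by
    obtain ⟨j, hj, hjmax⟩ := Finset.exists_max_image
      (Finset.univ.filter fun q => ∃ h : p₀ ≤ q, V.map h v ≠ 0) id
      ⟨p₀, by simpa [map_refl_apply] using hv⟩
    exact ⟨j, by simpa using hj, fun q hq => hjmax q (by simpa using hq)⟩
  obtain ⟨φ, hφ⟩ : ∃ φ : V.obj j →ₗ[F] F, φ (V.map hpj v) = 1 := by
    obtain ⟨φ, hφ⟩ := not_forall.1 fun h => hvj ((Module.forall_dual_apply_eq_zero_iff F _).1 h)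
    exact ⟨(φ (V.map hpj v))⁻¹ • φ, by simp [hφ]⟩
  -- the bar spanned by `v`
  set w : ∀ p, V.obj p := fun p => if h : p₀ ≤ p then V.map h v else 0 with hw
  have hw1 : ∀ p (h : p₀ ≤ p), w p = V.map h v := fun p h => dif_pos h
  have hw0 : ∀ p, ¬ (p₀ ≤ p ∧ p ≤ j) → w p = 0 := by
    intro p hp
    by_cases h : p₀ ≤ p
    · rw [hw1 p h]
      by_contra hne
      exact hp ⟨h, hjmax p ⟨h, hne⟩⟩
    · exact dif_neg h
  have hwK : ∀ p, w p ∈ K p := by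
    intro p
    by_cases h : p₀ ≤ p
    · rw [hw1 p h]; exact hK _ _ _ _ hvK
    · rw [hw, show (fun p => if h : p₀ ≤ p then V.map h v else 0) p = 0 from dif_neg h]
      exact zero_mem _
  have hwφ : ∀ p (h : p ≤ j), p₀ ≤ p → φ (V.map h (w p)) = 1 := by
    intro p h h'
    rw [hw1 p h', map_map, hφ]
  set K' : ∀ p, Submodule F (V.obj p) := fun p =>
    if h : p ≤ j then K p ⊓ LinearMap.ker (φ ∘ₗ V.map h) else K p with hK'
  have hK'1 : ∀ p (h : p ≤ j) x, x ∈ K' p ↔ x ∈ K p ∧ φ (V.map h x) = 0 := by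
    intro p h x
    rw [hK', show (fun p => if h : p ≤ j then K p ⊓ LinearMap.ker (φ ∘ₗ V.map h) else K p) p = _
      from dif_pos h]
    simp
  have hK'0 : ∀ p, ¬ p ≤ j → K' p = K p := fun p h => dif_neg h
  have hle : ∀ p, K' p ≤ K p := by
    intro p x hx
    by_cases h : p ≤ j
    · exact ((hK'1 p h x).1 hx).1
    · rwa [hK'0 p h] at hx
  have hmap : ∀ p q (h : p ≤ q), ∀ x ∈ K' p, V.map h x ∈ K' q := by
    intro p q h x hx
    by_cases hq : q ≤ j
    · rw [hK'1 q hq, map_map]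
      exact ⟨hK _ _ _ _ (hle p hx), ((hK'1 p (h.trans hq) x).1 hx).2⟩
    · rw [hK'0 q hq]; exact hK _ _ _ _ (hle p hx)
  have hlt : ∑ p, Module.finrank F (K' p) < n := by
    rw [← hn]
    refine Finset.sum_lt_sum (fun p _ => Submodule.finrank_mono (hle p)) ⟨p₀, Finset.mem_univ _, ?_⟩
    refine Submodule.finrank_lt_finrank_of_lt (lt_of_le_of_ne (hle p₀) fun h => ?_)
    have h1 := (hK'1 p₀ hpj v).1 (h ▸ hvK)
    rw [hφ] at h1
    exact one_ne_zero h1.2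
  obtain ⟨m, b, d, e, hbd, he⟩ := ih _ hlt K' hmap rfl
  have hlt_iff : ∀ p : P, (p : WithTop P) < (Finset.univ.filter fun q => j < q).min ↔ p ≤ j := by
    intro p
    constructor
    · intro h
      by_contra hp
      exact absurd h (not_lt.2 (Finset.min_le (by simpa using hp)))
    · intro h
      rcases hmn : (Finset.univ.filter fun q => j < q).min with _ | q
      · exact WithTop.coe_lt_top _
      · have := Finset.mem_of_min hmn
        exact WithTop.coe_lt_coe.2 (h.trans_lt (by simpa using this))
  refine ⟨m + 1, Fin.cons p₀ b, Fin.cons (Finset.univ.filter fun q => j < q).min d,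
    Fin.cons w e, ?_, ?_⟩
  · intro i
    refine Fin.cases ?_ (fun i => ?_) i
    · simpa [hlt_iff] using hpj
    · simpa using hbd i
  constructor
  · intro i p
    refine Fin.cases ?_ (fun i => ?_) i
    · exact hwK p
    · exact hle p (he.mem i p)
  · intro i p
    refine Fin.cases ?_ (fun i => ?_) i
    · simp only [Fin.cons_zero, Set.mem_ofPred_eq, hlt_iff]
      exact hw0 p
    · simpa using he.eq_zero i p
  · intro p a ha hsum
    rw [Fin.sum_univ_succ] at hsum
    simp only [Fin.cons_zero, Fin.cons_succ] at hsum
    have ha0 := ha 0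
    simp only [Fin.cons_zero, Set.mem_ofPred_eq, hlt_iff] at ha0
    have hz : a 0 = 0 := by
      by_cases hp : p₀ ≤ p ∧ p ≤ j
      · have h1 : φ (V.map hp.2 (∑ i : Fin m, a i.succ • e i p)) = 0 :=
          ((hK'1 p hp.2 _).1 (Submodule.sum_mem _ fun i _ => Submodule.smul_mem _ _ (he.mem i p))).2
        have h2 := congrArg (fun x => φ (V.map hp.2 x)) hsum
        simp only [map_add, map_smul, h1, hwφ p hp.2 hp.1, map_zero] at h2
        simpa using h2
      · exact ha0 hp
    have hrest : (fun i : Fin m => a i.succ) = 0 := by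
      refine he.indep p _ (fun i hi => ha i.succ (by simpa using hi)) ?_
      simpa [hz] using hsum
    funext i
    refine Fin.cases hz (fun i => congrFun hrest i) i
  · intro p x hx
    by_cases hp : p₀ ≤ p ∧ p ≤ j
    · set r := φ (V.map hp.2 x) with hr
      have hx' : x - r • w p ∈ K' p := by
        rw [hK'1 p hp.2]
        refine ⟨Submodule.sub_mem _ hx (Submodule.smul_mem _ _ (hwK p)), ?_⟩
        simp [hwφ p hp.2 hp.1, hr]
      obtain ⟨a, ha, hax⟩ := he.span p _ hx'
      refine ⟨Fin.cons r a, fun i => ?_, ?_⟩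
      · refine Fin.cases ?_ (fun i => ?_) i
        · simp only [Fin.cons_zero, Set.mem_ofPred_eq, hlt_iff]
          exact fun h => absurd hp h
        · simpa using ha i
      · rw [Fin.sum_univ_succ]
        simp [hax]
    · have hx' : x ∈ K' p := by
        by_cases hj : p ≤ j
        · have : K p = ⊥ := by
            by_contra hne
            exact hp ⟨hmin p hne, hj⟩
          rw [this, Submodule.mem_bot] at hx
          rw [hx]; exact zero_mem _
        · rwa [hK'0 p hj]
      obtain ⟨a, ha, hax⟩ := he.span p _ hx'
      refine ⟨Fin.cons 0 a, fun i => ?_, ?_⟩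
      · refine Fin.cases ?_ (fun i => ?_) i
        · simp
        · simpa using ha i
      · rw [Fin.sum_univ_succ]
        simp [hax]
  · intro i p q h
    refine Fin.cases ?_ (fun i => ?_) i
    · simp only [Fin.cons_zero, Set.mem_ofPred_eq, hlt_iff]
      intro hp
      rw [hw1 p hp.1, map_map, hw1 q (hp.1.trans h)]
    · simpa using he.map_eq i p q h

/-! ### Bar bases and diagrams -/

/-- The sections of the summands of a direct sum of interval modules form a bar basis. -/
theorem IsDiagramOf.exists_isBarBasis {F : Type u} [Field F] {V : PersistenceModule.{u, v} F ℝ}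
    {D : Multiset Bar} (h : IsDiagramOf V D) :
    ∃ (n : ℕ) (I : Fin n → Bar) (e : Fin n → ∀ s, V.obj s), D = Finset.univ.val.map I ∧
      V.IsBarBasis (fun _ => ⊤) (fun i => {s | (I i).Contains s}) e := by
  classical
  obtain ⟨n, I, rfl, φ, hφ⟩ := h
  have hmem : ∀ (i : Fin n) (s : ℝ) (a : F), (¬ (I i).Contains s → a = 0) →
      a ∈ (if (I i).Contains s then ⊤ else ⊥ : Submodule F F) := by
    intro i s a ha
    split_ifs with hc
    · trivial
    · exact ha hc
  let E : Fin n → ∀ s, (directSum fun j => (I j).intervalModule F).obj s := fun i s j =>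
    ⟨if j = i ∧ (I j).Contains s then 1 else 0, hmem j s _ fun h => if_neg fun h' => h h'.2⟩
  have hE : ∀ i s j, ((E i s j).1 : F) = if j = i ∧ (I j).Contains s then 1 else 0 :=
    fun _ _ _ => rfl
  have hsum : ∀ (s : ℝ) (a : Fin n → F) (j : Fin n),
      (((∑ i, a i • E i s : (directSum fun j => (I j).intervalModule F).obj s) j).1 : F)
        = if (I j).Contains s then a j else 0 := by
    intro s a j
    have : (((∑ i, a i • E i s : (directSum fun j => (I j).intervalModule F).obj s) j).1 : F)
        = ∑ i, a i * (E i s j).1 := by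
      erw [Finset.sum_apply, AddSubmonoidClass.coe_finsetSum]
      rfl
    rw [this]
    simp only [hE]
    by_cases hc : (I j).Contains s <;> simp [hc]
  refine ⟨n, I, fun i s => (φ s).symm (E i s), rfl, fun _ _ => trivial, ?_, ?_, ?_, ?_⟩
  · intro i s hs
    rw [LinearEquiv.map_eq_zero_iff]
    funext j
    apply Subtype.ext
    rw [hE, if_neg]
    · rfl
    · rintro ⟨rfl, h⟩
      exact hs h
  · intro s a ha h0
    have h0' : (φ s).symm (∑ i, a i • E i s) = 0 := by
      rw [map_sum]
      simpa only [map_smul] using h0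
    rw [LinearEquiv.map_eq_zero_iff] at h0'
    funext j
    by_cases hc : (I j).Contains s
    · refine ((hsum s a j).trans (if_pos hc)).symm.trans ?_
      exact congrArg (fun z : (directSum fun j => (I j).intervalModule F).obj s =>
        ((z j).1 : F)) h0'
    · exact ha j hc
  · intro s x _
    refine ⟨fun j => ((φ s x j).1 : F), fun j hj => ?_, ?_⟩
    · exact Bar.eq_zero_of_not_contains hj (φ s x j).2
    · have : (φ s).symm (∑ i, ((φ s x i).1 : F) • E i s) = x := by
        rw [LinearEquiv.symm_apply_eq]
        funext j
        apply Subtype.ext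
        rw [hsum]
        split_ifs with hc
        · rfl
        · exact (Bar.eq_zero_of_not_contains hc (φ s x j).2).symm
      rw [map_sum] at this
      simpa only [map_smul] using this
  · intro i s t hst hs
    rw [LinearEquiv.eq_symm_apply, hφ, LinearEquiv.apply_symm_apply]
    funext j
    apply Subtype.ext
    rw [hE]
    change ((((I j).intervalModule F).map hst (E i s j)).1 : F) = _
    by_cases ht : (I j).Contains t
    · have : ((((I j).intervalModule F).map hst (E i s j)).1 : F) = (E i s j).1 := by
        simp only [Bar.intervalModule]
        rw [dif_pos ht]
        rfl
      rw [this, hE]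
      by_cases hji : j = i
      · subst hji
        have hs' : (I j).Contains s := hs
        simp [hs', ht]
      · simp [hji]
    · have : ((((I j).intervalModule F).map hst (E i s j)).1 : F) = 0 := by
        simp only [Bar.intervalModule]
        rw [dif_neg ht]
        rfl
      rw [this, if_neg fun h => ht h.2]

/-- A bar basis with intervals as supports gives a decomposition into interval modules. -/
theorem PersistenceModule.IsBarBasis.isDiagramOf {F : Type u} [Field F]
    {V : PersistenceModule.{u, v} F ℝ} {ι : Type} [Fintype ι] {I : ι → Bar}
    {e : ι → ∀ s, V.obj s}
    (h : V.IsBarBasis (fun _ => ⊤) (fun i => {s | (I i).Contains s}) e) :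
    IsDiagramOf V (Finset.univ.val.map I) := by
  classical
  let σ := (Fintype.equivFin ι).symm
  refine ⟨Fintype.card ι, I ∘ σ, ?_, ?_⟩
  · rw [← Multiset.map_map]
    congr 1
    exact (Multiset.map_univ_val_equiv σ).symm
  let T : ∀ s, (directSum fun j => ((I ∘ σ) j).intervalModule F).obj s →ₗ[F] V.obj s := fun s =>
    ∑ j, (LinearMap.toSpanSingleton F (V.obj s) (e (σ j) s)) ∘ₗ
      (Submodule.subtype (if ((I ∘ σ) j).Contains s then ⊤ else ⊥ : Submodule F F)) ∘ₗ
        LinearMap.proj j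
  have hT : ∀ s x, T s x = ∑ j, ((x j).1 : F) • e (σ j) s := by
    intro s x
    simp only [T, LinearMap.sum_apply]
    rfl
  have hT' : ∀ s x, T s x = ∑ i, ((x (σ.symm i)).1 : F) • e i s := by
    intro s x
    rw [hT, ← Equiv.sum_comp σ]
    exact Finset.sum_congr rfl fun j _ => by rw [Equiv.symm_apply_apply]
  have hbij : ∀ s, Function.Bijective (T s) := by
    intro s
    constructor
    · rw [← LinearMap.ker_eq_bot, LinearMap.ker_eq_bot']
      intro x hx
      rw [hT'] at hx
      have := h.indep s _ (fun i hi => Bar.eq_zero_of_not_contains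
        (I := (I ∘ σ) (σ.symm i)) (by simpa using hi) (x (σ.symm i)).2) hx
      funext j
      apply Subtype.ext
      have hj : ((x (σ.symm (σ j))).1 : F) = 0 := congrFun this (σ j)
      rwa [Equiv.symm_apply_apply] at hj
    · intro y
      obtain ⟨a, ha, hay⟩ := h.span s y trivial
      have hmem : ∀ j, a (σ j) ∈ (if ((I ∘ σ) j).Contains s then ⊤ else ⊥ : Submodule F F) := by
        intro j
        split_ifs with hc
        · trivial
        · exact ha _ hc
      refine ⟨fun j => ⟨a (σ j), hmem j⟩, (hT s _).trans ?_⟩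
      rw [← hay, ← Equiv.sum_comp σ]
  refine ⟨fun s => (LinearEquiv.ofBijective (T s) (hbij s)).symm, ?_⟩
  intro s t hst x
  obtain ⟨y, rfl⟩ := (hbij s).2 x
  rw [LinearEquiv.symm_apply_eq]
  have : (LinearEquiv.ofBijective (T s) (hbij s)).symm (T s y) = y :=
    (LinearEquiv.ofBijective (T s) (hbij s)).symm_apply_apply y
  rw [this]
  change V.map hst (T s y) = T t _
  rw [hT, hT, map_sum]
  refine Finset.sum_congr rfl fun j _ => ?_
  rw [map_smul]
  change _ = ((((I (σ j)).intervalModule F).map hst (y j)).1 : F) • _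
  by_cases hs : (I (σ j)).Contains s
  · rw [h.map_eq (σ j) s t hst hs]
    by_cases ht : (I (σ j)).Contains t
    · congr 1
      simp only [Bar.intervalModule]
      rw [dif_pos ht]
      rfl
    · rw [h.eq_zero (σ j) t ht, smul_zero, smul_zero]
  · have h0 : ((y j).1 : F) = 0 := Bar.eq_zero_of_not_contains hs (y j).2
    have : y j = 0 := Subtype.ext h0
    rw [this, map_zero, h.eq_zero (σ j) s hs, map_zero, smul_zero]
    exact (zero_smul F _).symm

/-! ### Uniqueness of diagrams -/

/-- The rank of a transition map is the number of bars that contain both parameters. -/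
theorem PersistenceModule.IsBarBasis.finrank_range {F : Type u} [Field F] {P : Type*} [Preorder P]
    {V : PersistenceModule.{u, v} F P} {ι : Type} [Fintype ι] {S : ι → Set P}
    {e : ι → ∀ s, V.obj s} (h : V.IsBarBasis (fun _ => ⊤) S e) {p q : P} (hpq : p ≤ q)
    [DecidablePred fun i => p ∈ S i ∧ q ∈ S i] :
    Module.finrank F (LinearMap.range (V.map hpq)) =
      (Finset.univ.filter fun i => p ∈ S i ∧ q ∈ S i).card := by
  classical
  have hli : LinearIndependent F fun i : {i // p ∈ S i ∧ q ∈ S i} => e i q := by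
    rw [Fintype.linearIndependent_iff]
    intro g hg i
    have := h.indep q (fun i => if hi : p ∈ S i ∧ q ∈ S i then g ⟨i, hi⟩ else 0)
      (fun i hi => dif_neg fun h => hi h.2) ?_
    · have hi := congrFun this i.1
      rwa [dif_pos i.2] at hi
    · rw [← hg, ← Finset.sum_filter_of_ne (p := fun i => p ∈ S i ∧ q ∈ S i),
        Finset.sum_subtype _ (p := fun i => p ∈ S i ∧ q ∈ S i) (by simp)]
      · exact Finset.sum_congr rfl fun i _ => by rw [dif_pos i.2]
      · intro i _ hi
        by_contra hn
        exact hi (by rw [dif_neg hn, zero_smul])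
  have hspan : LinearMap.range (V.map hpq) =
      Submodule.span F (Set.range fun i : {i // p ∈ S i ∧ q ∈ S i} => e i q) := by
    apply le_antisymm
    · rintro _ ⟨x, rfl⟩
      obtain ⟨a, ha, rfl⟩ := h.span p x trivial
      rw [map_sum]
      refine Submodule.sum_mem _ fun i _ => ?_
      rw [map_smul]
      refine Submodule.smul_mem _ _ ?_
      by_cases hp : p ∈ S i
      · rw [h.map_eq i p q hpq hp]
        by_cases hq : q ∈ S i
        · exact Submodule.subset_span ⟨⟨i, hp, hq⟩, rfl⟩
        · rw [h.eq_zero i q hq]; exact zero_mem _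
      · rw [h.eq_zero i p hp, map_zero]; exact zero_mem _
    · rw [Submodule.span_le]
      rintro _ ⟨i, rfl⟩
      exact ⟨e i p, h.map_eq i p q hpq i.2.1⟩
  rw [hspan, finrank_span_eq_card hli, Fintype.card_subtype]

/-- A finite multiset of bars is determined by the numbers of bars containing given pairs of
parameters. If these numbers agree, every bar of one multiset is contained in a bar of the other, so
the multisets share their maximal bars, and one of these can be removed. -/
theorem Bar.multiset_ext (D : Multiset Bar) : ∀ E : Multiset Bar,
    (∀ s t : ℝ, s ≤ t → D.countP (fun I => I.birth ≤ s ∧ (t : WithTop ℝ) < I.death) =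
      E.countP fun I => I.birth ≤ s ∧ (t : WithTop ℝ) < I.death) → D = E := by
  classical
  have key : ∀ D E : Multiset Bar,
      (∀ s t : ℝ, s ≤ t → D.countP (fun I => I.birth ≤ s ∧ (t : WithTop ℝ) < I.death) =
        E.countP fun I => I.birth ≤ s ∧ (t : WithTop ℝ) < I.death) →
      ∀ I ∈ D, ∃ J ∈ E, J.birth ≤ I.birth ∧ I.death ≤ J.death := by
    intro D E h I hI
    have hex : ∀ t, I.birth ≤ t → (t : WithTop ℝ) < I.death →
        ∃ J ∈ E, J.birth ≤ I.birth ∧ (t : WithTop ℝ) < J.death := by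
      intro t ht ht'
      have : 0 < D.countP fun J => J.birth ≤ I.birth ∧ (t : WithTop ℝ) < J.death :=
        Multiset.countP_pos.2 ⟨I, hI, le_rfl, ht'⟩
      rw [h _ _ ht] at this
      exact Multiset.countP_pos.1 this
    obtain ⟨J₀, hJ₀, hb, -⟩ := hex I.birth le_rfl I.lt
    obtain ⟨J, hJ, hmax⟩ := Finset.exists_max_image
      (E.toFinset.filter fun J => J.birth ≤ I.birth) Bar.death ⟨J₀, by simp [hJ₀, hb]⟩
    simp only [Finset.mem_filter, Multiset.mem_toFinset] at hJ hmax
    refine ⟨J, hJ.1, hJ.2, not_lt.1 fun hlt => ?_⟩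
    obtain ⟨t, ht⟩ := WithTop.ne_top_iff_exists.1 (ne_top_of_lt hlt)
    obtain ⟨J', hJ', hb', hd'⟩ := hex (max I.birth t) (le_max_left _ _) (by
      rw [WithTop.coe_max]
      exact max_lt I.lt (ht ▸ hlt))
    have h1 := hmax J' ⟨hJ', hb'⟩
    rw [← ht] at h1
    exact absurd h1 (not_le.2 (lt_of_le_of_lt (WithTop.coe_le_coe.2 (le_max_right _ _)) hd'))
  induction hn : D.card generalizing D with
  | zero =>
    intro E h
    rw [Multiset.card_eq_zero] at hn
    subst hn
    refine (Multiset.eq_zero_of_forall_notMem fun J hJ => ?_).symm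
    obtain ⟨I, hI, -⟩ := key E 0 (fun s t hst => (h s t hst).symm) J hJ
    simp at hI
  | succ n ih =>
    intro E h
    obtain ⟨I₀, hI₀⟩ := Multiset.card_pos_iff_exists_mem.1 (by omega : 0 < D.card)
    obtain ⟨I₁, hI₁, hmin⟩ := Finset.exists_min_image D.toFinset Bar.birth ⟨I₀, by simpa using hI₀⟩
    obtain ⟨I, hI, hmax⟩ := Finset.exists_max_image
      (D.toFinset.filter fun J => J.birth = I₁.birth) Bar.death ⟨I₁, by simpa using hI₁⟩
    simp only [Finset.mem_filter, Multiset.mem_toFinset] at hI hmax hmin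
    obtain ⟨J, hJ, hJb, hJd⟩ := key D E h I hI.1
    obtain ⟨I', hI', hIb, hId⟩ := key E D (fun s t hst => (h s t hst).symm) J hJ
    have hb : I'.birth = I₁.birth := le_antisymm (by linarith [hI.2]) (hmin I' hI')
    have hd := hmax I' ⟨hI', hb⟩
    have hJI : J = I := by
      obtain ⟨Jb, Jd, _⟩ := J
      obtain ⟨Ib, Id, _⟩ := I
      simp only [Bar.mk.injEq]
      exact ⟨le_antisymm hJb (by simp only at hI hIb; linarith [hI.2]),
        le_antisymm (hId.trans hd) hJd⟩
    subst hJI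
    obtain ⟨D', rfl⟩ := Multiset.exists_cons_of_mem hI.1
    obtain ⟨E', rfl⟩ := Multiset.exists_cons_of_mem hJ
    rw [ih D' (by simpa using hn) E']
    intro s t hst
    have := h s t hst
    rw [Multiset.countP_cons, Multiset.countP_cons] at this
    omega

/-- The number of bars of a diagram that contain `s` and `t` is the rank of the transition map. -/
theorem IsDiagramOf.countP_eq {F : Type u} [Field F] {V : PersistenceModule.{u, v} F ℝ}
    {D : Multiset Bar} (h : IsDiagramOf V D) {s t : ℝ} (hst : s ≤ t) :
    D.countP (fun I => I.birth ≤ s ∧ (t : WithTop ℝ) < I.death) =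
      Module.finrank F (LinearMap.range (V.map hst)) := by
  classical
  obtain ⟨n, I, e, rfl, he⟩ := h.exists_isBarBasis
  rw [he.finrank_range hst, Multiset.countP_map, Finset.card_def, Finset.filter_val]
  congr 1
  refine Multiset.filter_congr fun i _ => ?_
  constructor
  · rintro ⟨h1, h2⟩
    exact ⟨⟨h1, (WithTop.coe_le_coe.2 hst).trans_lt h2⟩, h1.trans hst, h2⟩
  · rintro ⟨h1, h2⟩
    exact ⟨h1.1, h2.2⟩

theorem IsDiagramOf.unique {F : Type u} [Field F] {V : PersistenceModule.{u, v} F ℝ}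
    {D E : Multiset Bar} (hD : IsDiagramOf V D) (hE : IsDiagramOf V E) : D = E :=
  Bar.multiset_ext D E fun _ _ hst => by rw [hD.countP_eq hst, hE.countP_eq hst]

theorem IsDiagramOf.dgm_eq {F : Type u} [Field F] {V : PersistenceModule.{u, v} F ℝ}
    {D : Multiset Bar} (h : IsDiagramOf V D) : dgm V = D := by
  have hex : ∃ D, IsDiagramOf V D := ⟨D, h⟩
  rw [dgm, dif_pos hex]
  exact hex.choose_spec.unique h

/-- Sections with empty support can be removed from a bar basis. -/
theorem PersistenceModule.IsBarBasis.subtype {F : Type u} [Field F] {P : Type*} [Preorder P]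
    {V : PersistenceModule.{u, v} F P} {K : ∀ p, Submodule F (V.obj p)} {ι : Type} [Fintype ι]
    {S : ι → Set P} {e : ι → ∀ s, V.obj s} (h : V.IsBarBasis K S e) (A : ι → Prop)
    [DecidablePred A] (hA : ∀ i, ¬ A i → S i = ∅) :
    V.IsBarBasis K (fun i : {i // A i} => S i) (fun i : {i // A i} => e i) := by
  have hsum : ∀ p (a : ι → F), ∑ i : {i // A i}, a i • e i p = ∑ i, a i • e i p := by
    intro p a
    rw [← Finset.sum_filter_of_ne (p := A), Finset.sum_subtype _ (p := A) (by simp)]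
    intro i _ hi
    by_contra hn
    exact hi (by rw [h.eq_zero i p (by simp [hA i hn]), smul_zero])
  refine ⟨fun i p => h.mem i p, fun i p => h.eq_zero i p, ?_, ?_, fun i => h.map_eq i⟩
  · intro p a ha h0
    have := h.indep p (fun i => if hi : A i then a ⟨i, hi⟩ else 0) ?_ ?_
    · funext i
      have hi := congrFun this i.1
      rwa [dif_pos i.2] at hi
    · intro i hi
      by_cases hAi : A i
      · rw [dif_pos hAi]; exact ha ⟨i, hAi⟩ hi
      · rw [dif_neg hAi]
    · rw [← hsum, ← h0]
      exact Finset.sum_congr rfl fun i _ => by rw [dif_pos i.2]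
  · intro p x hx
    obtain ⟨a, ha, rfl⟩ := h.span p x hx
    exact ⟨fun i => a i, fun i => ha i, hsum p a⟩

theorem Multiset.filterMap_univ_val {ι β : Type*} [Fintype ι] (g : ι → Option β)
    [DecidablePred fun i => (g i).isSome] :
    (Finset.univ : Finset ι).val.filterMap g =
      (Finset.univ : Finset {i // (g i).isSome}).val.map
        fun i : {i // (g i).isSome} => (g i).get i.2 := by
  have h1 : (Finset.univ : Finset ι).val.filterMap g =
      ((Finset.univ : Finset ι).val.filter fun i => (g i).isSome).filterMap g := by
    induction (Finset.univ : Finset ι).val using Multiset.induction_on with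
    | empty => rfl
    | cons a s ih =>
      rcases hg : g a with _ | b
      · rw [Multiset.filterMap_cons_none _ _ hg, ih, Multiset.filter_cons_of_neg _ (by simp [hg])]
      · rw [Multiset.filterMap_cons_some _ _ _ hg, ih, Multiset.filter_cons_of_pos _ (by simp [hg]),
          Multiset.filterMap_cons_some _ _ _ hg]
  have h2 : ((Finset.univ : Finset ι).val.filter fun i => (g i).isSome) =
      (Finset.univ : Finset {i // (g i).isSome}).val.map Subtype.val := by
    rw [← Finset.filter_val, ← Finset.subtype_map]
    simp [Finset.map_val]
  have h3 : (fun i : {i // (g i).isSome} => g i) =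
      some ∘ fun i : {i // (g i).isSome} => (g i).get i.2 :=
    funext fun i => (Option.some_get i.2).symm
  rw [h1, h2, Multiset.filterMap_map, ← Multiset.filterMap_eq_map]
  exact congrArg (fun f => Multiset.filterMap f _) h3

/-! ### Symbolic barcodes -/

/-- The realisation of a symbolic bar, given by the positions of its birth and its death (`⊤` if it
never dies) in a poset `Q`, under a function `h` that assigns parameter values to the elements of
`Q`. It is `none` if the resulting interval is empty. -/
def realizeBar {Q : Type*} (h : Q → ℝ) (x : Q × WithTop Q) : Option Bar :=
  open Classical in
  if hlt : (h x.1 : WithTop ℝ) < x.2.map h then some ⟨h x.1, x.2.map h, hlt⟩ else none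

theorem Set.Finite.exists_isGreatest_of_supClosed {Q : Type*} [SemilatticeSup Q] {A : Set Q}
    (hA : A.Finite) (hne : A.Nonempty) (hsup : SupClosed A) : ∃ x, IsGreatest A x := by
  have hne' : hA.toFinset.Nonempty := by simpa using hne
  refine ⟨hA.toFinset.sup' hne' id, hsup.finsetSup'_mem hne' (by simp), fun x hx => ?_⟩
  exact Finset.le_sup' id (by simpa using hx)

theorem supClosed_inter_le {Q : Type*} [SemilatticeSup Q] {C : Set Q} (hC : SupClosed C)
    (h : SupHom Q ℝ) (s : ℝ) : SupClosed {x | x ∈ C ∧ h x ≤ s} := by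
  rintro x ⟨hx, hxs⟩ y ⟨hy, hys⟩
  exact ⟨hC hx hy, by rw [map_sup]; exact sup_le hxs hys⟩

theorem SupHom.mono {Q : Type*} [SemilatticeSup Q] (h : SupHom Q ℝ) : Monotone h :=
  OrderHomClass.mono h

section Rank

variable {F : Type u} [Field F] {M : PersistenceModule.{u, v} F (Fin 2 → ℝ)}
  {C : Set (Fin 2 → ℝ)}

theorem PersistenceModule.rank_map_refl {P : Type*} [Preorder P] (M : PersistenceModule.{u, v} F P)
    (p : P) (h : p ≤ p) : (M.map h).rank = Module.rank F (M.obj p) := by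
  rw [M.map_refl]
  rw [LinearMap.rank, LinearMap.range_id, rank_top]

/-- The transition map from the greatest critical value below `y` is an isomorphism, since property
(P) equates its rank with the dimensions of both of its ends. -/
theorem IsCriticalSet.bijective_map (hM : M.PointwiseFinite) (hC : IsCriticalSet M C)
    {x y : Fin 2 → ℝ} (hx : x ∈ supClosure C) (hxy : x ≤ y)
    (hy : ∀ z ∈ supClosure C, z ≤ y → z ≤ x) : Function.Bijective (M.map hxy) := by
  have hfin : ∀ p, FiniteDimensional F (M.obj p) := hM
  have hgx : IsGreatest {c | c ∈ supClosure C ∧ c ≤ x} x := ⟨⟨hx, le_rfl⟩, fun z hz => hz.2⟩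
  have hgy : IsGreatest {c | c ∈ supClosure C ∧ c ≤ y} x := ⟨⟨hx, hxy⟩, fun z hz => hy z hz.1 hz.2⟩
  have h1 := (hC.2 x y hxy).1 x x le_rfl hgx hgy
  have h2 := (hC.2 y y le_rfl).1 x x le_rfl hgy hgy
  rw [rank_map_refl] at h1 h2
  rw [rank_map_refl] at h2
  have h1' : Module.finrank F (LinearMap.range (M.map hxy)) = Module.finrank F (M.obj x) :=
    congrArg Cardinal.toNat h1
  have h2' : Module.finrank F (M.obj y) = Module.finrank F (M.obj x) := congrArg Cardinal.toNat h2
  have hsurj : Function.Surjective (M.map hxy) := by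
    rw [← LinearMap.range_eq_top]
    exact Submodule.eq_top_of_finrank_eq (h1'.trans h2'.symm)
  exact ⟨(LinearMap.injective_iff_surjective_of_finrank_eq_finrank h2'.symm).2 hsurj, hsurj⟩

theorem IsCriticalSet.subsingleton (hC : IsCriticalSet M C)
    {y : Fin 2 → ℝ} (hy : ∀ z ∈ supClosure C, ¬ z ≤ y) : Subsingleton (M.obj y) := by
  have := (hC.2 y y le_rfl).2 (by ext z; simpa using hy z)
  rw [rank_map_refl] at this
  exact rank_zero_iff.1 this

end Rank

/-- A module with finitely many critical values has a symbolic barcode, a multiset of bars with ends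
in `supClosure C`, that describes its restrictions to many curves at once. A curve `γ` enters the
picture through the parameter value `h x` at which it enters the cone above `x`. The symbolic
barcode computed from the order that `h₀` induces on the critical values is valid for all `h` that
respect this order weakly; the bars that become empty have to be dropped. -/
theorem IsCriticalSet.exists_symbolic_barcode {F : Type u} [Field F]
    {M : PersistenceModule.{u, v} F (Fin 2 → ℝ)} (hM : M.PointwiseFinite) {C : Set (Fin 2 → ℝ)}
    (hC : IsCriticalSet M C) (h₀ : SupHom (Fin 2 → ℝ) ℝ) :
    ∃ D : Multiset ((Fin 2 → ℝ) × WithTop (Fin 2 → ℝ)),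
      (∀ x ∈ D, x.1 ∈ supClosure C ∧ ∀ y : Fin 2 → ℝ, x.2 = y → y ∈ supClosure C) ∧
      ∀ h : SupHom (Fin 2 → ℝ) ℝ,
        (∀ x ∈ supClosure C, ∀ y ∈ supClosure C, h₀ x ≤ h₀ y → h x ≤ h y) →
        (∀ x ∈ D, (h x.1 : WithTop ℝ) ≤ x.2.map h) ∧
        ∀ (γ : ℝ → Fin 2 → ℝ) (hγ : Monotone γ), (∀ x ∈ supClosure C, ∀ s, x ≤ γ s ↔ h x ≤ s) →
          dgm (M.comap γ hγ) = D.filterMap (realizeBar h) := by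
  classical
  have hfin : (supClosure C).Finite := hC.1.supClosure
  let T : Finset ℝ := hfin.toFinset.image h₀
  have hgr : ∀ t : T, ∃ x, IsGreatest {x | x ∈ supClosure C ∧ h₀ x ≤ t} x := by
    rintro ⟨t, ht⟩
    refine (hfin.subset fun x hx => hx.1).exists_isGreatest_of_supClosed ?_
      (supClosed_inter_le supClosed_supClosure h₀ t)
    obtain ⟨x, hx, rfl⟩ := Finset.mem_image.1 ht
    exact ⟨x, by simpa using hx, le_rfl⟩
  choose c hc using hgr
  have hcC : ∀ t, c t ∈ supClosure C := fun t => (hc t).1.1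
  have hmono : Monotone c := fun s t hst => (hc t).2 ⟨hcC s, (hc s).1.2.trans hst⟩
  obtain ⟨m, b, d, e, hbd, he⟩ := exists_isBarBasis (M.comap c hmono) (fun t => hM (c t)) _
    (fun _ => ⊤) (fun _ _ _ _ _ => trivial) rfl
  obtain ⟨e, he0, heI, heS, heM⟩ : ∃ e : Fin m → ∀ p : T, M.obj (c p),
      (∀ i p, ¬ (b i ≤ p ∧ (p : WithTop T) < d i) → e i p = 0) ∧
      (∀ p (a : Fin m → F), (∀ i, ¬ (b i ≤ p ∧ (p : WithTop T) < d i) → a i = 0) →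
        ∑ i, a i • e i p = 0 → a = 0) ∧
      (∀ p x, ∃ a : Fin m → F, (∀ i, ¬ (b i ≤ p ∧ (p : WithTop T) < d i) → a i = 0) ∧
        ∑ i, a i • e i p = x) ∧
      ∀ i p q (h : p ≤ q), (b i ≤ p ∧ (p : WithTop T) < d i) → M.map (hmono h) (e i p) = e i q :=
    ⟨e, he.eq_zero, he.indep, fun p x => he.span p x trivial, he.map_eq⟩
  refine ⟨Finset.univ.val.map fun i => (c (b i), (d i).map c), ?_, ?_⟩
  · intro x hx
    obtain ⟨i, -, rfl⟩ := Multiset.mem_map.1 hx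
    refine ⟨hcC _, fun y hy => ?_⟩
    rcases hd : d i with _ | p
    · rw [hd] at hy
      exact absurd hy WithTop.top_ne_coe
    · rw [hd] at hy
      rw [← WithTop.coe_injective hy]
      exact hcC p
  intro h hh
  have hhc : Monotone fun t => h (c t) := fun s t hst => h.mono (hmono hst)
  refine ⟨fun x hx => ?_, fun γ hγ hγh => ?_⟩
  · obtain ⟨i, -, rfl⟩ := Multiset.mem_map.1 hx
    have := (hbd i).le
    rcases hd : d i with _ | p
    · exact le_top
    · rw [hd] at this
      exact WithTop.coe_le_coe.2 (hhc (WithTop.coe_le_coe.1 this))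
  -- `g s` is the last parameter of the chain that the curve has reached at time `s`
  have hg : ∀ s, (∃ p, h (c p) ≤ s) → ∃ g, h (c g) ≤ s ∧ ∀ p, h (c p) ≤ s → p ≤ g := by
    rintro s ⟨p, hp⟩
    obtain ⟨g, hg, hmax⟩ := Finset.exists_max_image (Finset.univ.filter fun p => h (c p) ≤ s) id
      ⟨p, by simpa using hp⟩
    exact ⟨g, by simpa using hg, fun q hq => hmax q (by simpa using hq)⟩
  choose g hgs hgmax using hg
  have hcγ : ∀ s hs, c (g s hs) ≤ γ s := fun s hs => (hγh _ (hcC _) s).2 (hgs s hs)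
  have hreach : ∀ x ∈ supClosure C, ∀ s, x ≤ γ s → ∃ p, x ≤ c p ∧ h (c p) ≤ s := by
    intro x hx s hxs
    have hT : h₀ x ∈ T := Finset.mem_image_of_mem _ (by simpa using hx)
    refine ⟨⟨h₀ x, hT⟩, (hc ⟨h₀ x, hT⟩).2 ⟨hx, le_rfl⟩, ?_⟩
    exact (hh _ (hcC _) x hx (hc ⟨h₀ x, hT⟩).1.2).trans ((hγh x hx s).1 hxs)
  have hbij : ∀ s hs, Function.Bijective (M.map (hcγ s hs)) := by
    intro s hs
    refine hC.bijective_map hM (hcC _) _ fun z hz hzs => ?_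
    obtain ⟨p, hzp, hp⟩ := hreach z hz s hzs
    exact hzp.trans (hmono (hgmax s hs p hp))
  have hsub : ∀ s, (¬ ∃ p, h (c p) ≤ s) → Subsingleton (M.obj (γ s)) := by
    intro s hs
    refine hC.subsingleton fun z hz hzs => hs ?_
    obtain ⟨p, -, hp⟩ := hreach z hz s hzs
    exact ⟨p, hp⟩
  have hgmono : ∀ s t hs ht, s ≤ t → g s hs ≤ g t ht := fun s t hs ht hst =>
    hgmax t ht _ ((hgs s hs).trans hst)
  let S : Fin m → Set ℝ := fun i =>
    {s | h (c (b i)) ≤ s ∧ (s : WithTop ℝ) < ((d i).map c).map h}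
  have hS : ∀ i s, s ∈ S i ↔ ∃ hs, b i ≤ g s hs ∧ (g s hs : WithTop T) < d i := by
    intro i s
    have h1 : ∀ hs, (s : WithTop ℝ) < ((d i).map c).map h ↔ (g s hs : WithTop T) < d i := by
      intro hs
      rcases d i with _ | p
      · exact ⟨fun _ => WithTop.coe_lt_top _, fun _ => WithTop.coe_lt_top _⟩
      · refine WithTop.coe_lt_coe.trans (Iff.trans ?_ WithTop.coe_lt_coe.symm)
        rw [← not_le, ← not_le]
        exact not_congr ⟨fun hp => hgmax s hs p hp, fun hp => (hhc hp).trans (hgs s hs)⟩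
    constructor
    · rintro ⟨hb, hd⟩
      have hs : ∃ p, h (c p) ≤ s := ⟨_, hb⟩
      exact ⟨hs, hgmax s hs _ hb, (h1 hs).1 hd⟩
    · rintro ⟨hs, hb, hd⟩
      exact ⟨(hhc hb).trans (hgs s hs), (h1 hs).2 hd⟩
  let E : Fin m → ∀ s, M.obj (γ s) := fun i s =>
    if hs : ∃ p, h (c p) ≤ s then M.map (hcγ s hs) (e i (g s hs)) else 0
  have hE1 : ∀ i s hs, E i s = M.map (hcγ s hs) (e i (g s hs)) := fun i s hs => dif_pos hs
  have hE0 : ∀ i s, (¬ ∃ p, h (c p) ≤ s) → E i s = 0 := fun i s hs => dif_neg hs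
  have hsum : ∀ s hs (a : Fin m → F),
      ∑ i, a i • E i s = M.map (hcγ s hs) (∑ i, a i • e i (g s hs)) := by
    intro s hs a
    rw [map_sum]
    exact Finset.sum_congr rfl fun i _ => by rw [hE1 i s hs, map_smul]
  have hEb : (M.comap γ hγ).IsBarBasis (fun _ => ⊤) S E := by
    refine ⟨fun _ _ => trivial, ?_, ?_, ?_, ?_⟩
    · intro i s hi
      by_cases hs : ∃ p, h (c p) ≤ s
      · exact (hE1 i s hs).trans ((congrArg _ (he0 i (g s hs) fun h' =>
          hi ((hS i s).2 ⟨hs, h'⟩))).trans (map_zero _))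
      · exact hE0 i s hs
    · intro s a ha h0
      by_cases hs : ∃ p, h (c p) ≤ s
      · replace h0 := (hsum s hs a).symm.trans h0
        refine heI (g s hs) a (fun i hi => ha i fun h' => hi ?_)
          ((hbij s hs).1 (h0.trans (map_zero _).symm))
        exact ((hS i s).1 h').2
      · exact funext fun i => ha i fun h' => hs ((hS i s).1 h').1
    · intro s x _
      by_cases hs : ∃ p, h (c p) ≤ s
      · obtain ⟨y, rfl⟩ := (hbij s hs).2 x
        obtain ⟨a, ha, hy⟩ := heS (g s hs) y
        refine ⟨a, fun i hi => ha i fun h' => hi ((hS i s).2 ⟨hs, h'⟩), ?_⟩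
        exact (hsum s hs a).trans (by rw [hy])
      · have := hsub s hs
        exact ⟨0, fun _ _ => rfl, Subsingleton.elim (α := M.obj (γ s)) _ _⟩
    · intro i s t hst hi
      obtain ⟨hs, hi⟩ := (hS i s).1 hi
      have ht : ∃ p, h (c p) ≤ t := hs.imp fun p hp => hp.trans hst
      rw [hE1 i s hs, hE1 i t ht, ← heM i _ _ (hgmono s t hs ht hst) hi]
      change M.map (hγ hst) (M.map (hcγ s hs) _) = M.map (hcγ t ht) (M.map _ _)
      rw [map_map, map_map]
  let f : Fin m → Option Bar := fun i => realizeBar h (c (b i), (d i).map c)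
  have hf : ∀ i, (f i).isSome ↔ (h (c (b i)) : WithTop ℝ) < ((d i).map c).map h := by
    intro i
    simp only [f, realizeBar]
    split_ifs with hlt
    · exact iff_of_true rfl hlt
    · exact iff_of_false (by simp) hlt
  have hsubt := hEb.subtype (fun i => (f i).isSome) (by
    intro i hi
    rw [hf] at hi
    ext s
    simp only [Set.mem_empty_iff_false, iff_false]
    exact fun hs => hi ((WithTop.coe_le_coe.2 hs.1).trans_lt hs.2))
  have hI : ∀ i : {i // (f i).isSome},
      S i = {s | ((f i).get i.2).Contains s} := by
    rintro ⟨i, hi⟩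
    have hlt := (hf i).1 hi
    have : f i = some ⟨h (c (b i)), ((d i).map c).map h, hlt⟩ := dif_pos hlt
    simp only [this, Option.get_some]
    rfl
  simp only [hI] at hsubt
  rw [hsubt.isDiagramOf.dgm_eq, Multiset.filterMap_map]
  exact (Multiset.filterMap_univ_val f).symm

/-- Every sup-homomorphism is realised by a monotone curve, as far as a finite sup-closed set of
points is concerned. -/
theorem exists_monotone_curve {C : Set (Fin 2 → ℝ)} (hfin : C.Finite) (hC : SupClosed C)
    (h : SupHom (Fin 2 → ℝ) ℝ) :
    ∃ γ : ℝ → Fin 2 → ℝ, Monotone γ ∧ ∀ x ∈ C, ∀ s, x ≤ γ s ↔ h x ≤ s := by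
  classical
  obtain ⟨z₀, hz₀⟩ := hfin.bddBelow
  set z : Fin 2 → ℝ := z₀ - 1 with hz
  have hzlt : ∀ x ∈ C, z ≤ x ∧ ¬ x ≤ z := by
    intro x hx
    have h0 := hz₀ hx 0
    have h1 := hz₀ hx 1
    constructor
    · intro i
      have := hz₀ hx i
      simp only [hz, Pi.sub_apply, Pi.one_apply]
      linarith
    · intro hle
      have := hle 0
      simp only [hz, Pi.sub_apply, Pi.one_apply] at this
      linarith
  let A : ℝ → Finset (Fin 2 → ℝ) := fun s => hfin.toFinset.filter fun x => h x ≤ s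
  refine ⟨fun s => (insert z (A s)).sup' (Finset.insert_nonempty _ _) id, ?_, ?_⟩
  · intro s t hst
    refine Finset.sup'_mono _ (Finset.insert_subset_insert _ fun x hx => ?_) _
    simp only [A, Finset.mem_filter] at hx ⊢
    exact ⟨hx.1, hx.2.trans hst⟩
  · intro x hx s
    constructor
    · intro hle
      by_cases hne : {x | x ∈ C ∧ h x ≤ s}.Nonempty
      · obtain ⟨y, hy, hmax⟩ := (hfin.subset fun x hx => hx.1).exists_isGreatest_of_supClosed hne
          (supClosed_inter_le hC h s)
        refine (h.mono (hle.trans (Finset.sup'_le _ _ fun x hx => ?_))).trans hy.2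
        rcases Finset.mem_insert.1 hx with rfl | hx
        · exact (hzlt y hy.1).1
        · exact hmax (by simpa [A] using hx)
      · exfalso
        refine (hzlt x hx).2 (hle.trans (Finset.sup'_le _ _ fun y hy => ?_))
        rcases Finset.mem_insert.1 hy with rfl | hy
        · exact le_rfl
        · exact absurd ⟨y, by simpa [A] using hy⟩ hne
    · intro hle
      exact Finset.le_sup' id (Finset.mem_insert_of_mem (by simp [A, hx, hle]))

/-! ### Bottleneck costs of symbolic barcodes -/

theorem extAbsDiff_comm (a b : WithTop ℝ) : extAbsDiff a b = extAbsDiff b a := by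
  rcases a with _ | a <;> rcases b with _ | b <;> simp [extAbsDiff, abs_sub_comm]

/-- The cost of matching two symbolic bars when they are realised by `h`. -/
def symDist {Q : Type*} (h : Q → ℝ) (x y : Q × WithTop Q) : ℝ≥0∞ :=
  max (ENNReal.ofReal |h x.1 - h y.1|) (extAbsDiff (x.2.map h) (y.2.map h))

/-- The cost of leaving a symbolic bar unmatched when it is realised by `h`. -/
def symDiag {Q : Type*} (h : Q → ℝ) (x : Q × WithTop Q) : ℝ≥0∞ :=
  extAbsDiff (x.2.map h) (h x.1) / 2

/-- A matching of two symbolic barcodes. -/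
structure SymMatching {Q : Type*} (D E : Multiset (Q × WithTop Q)) where
  pairs : Multiset ((Q × WithTop Q) × (Q × WithTop Q))
  left : Multiset (Q × WithTop Q)
  right : Multiset (Q × WithTop Q)
  left_eq : pairs.map Prod.fst + left = D
  right_eq : pairs.map Prod.snd + right = E

/-- The greatest cost of a matched pair or of an unmatched symbolic bar under the realisation by
`h`. -/
def SymMatching.cost {Q : Type*} {D E : Multiset (Q × WithTop Q)} (σ : SymMatching D E)
    (h : Q → ℝ) : ℝ≥0∞ :=
  max (σ.pairs.map fun x => symDist h x.1 x.2).sup ((σ.left + σ.right).map (symDiag h)).sup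

/-- The bottleneck distance of the realisations of two symbolic barcodes, computed without
discarding the bars that become empty. -/
def symBottleneck {Q : Type*} (h : Q → ℝ) (D E : Multiset (Q × WithTop Q)) : ℝ≥0∞ :=
  ⨅ σ : SymMatching D E, σ.cost h

instance {Q : Type*} (D E : Multiset (Q × WithTop Q)) : Nonempty (SymMatching D E) :=
  ⟨⟨0, D, E, by simp, by simp⟩⟩

theorem BarMatching.cost_le_iff {D E : Multiset Bar} (σ : BarMatching D E) (r : ℝ≥0∞) :
    σ.cost ≤ r ↔ (∀ x ∈ σ.pairs, x.1.dist x.2 ≤ r) ∧ (∀ x ∈ σ.left, x.diagDist ≤ r) ∧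
      ∀ x ∈ σ.right, x.diagDist ≤ r := by
  simp only [BarMatching.cost, max_le_iff, Multiset.sup_le, Multiset.mem_map, Multiset.mem_add,
    forall_exists_index, and_imp, forall_apply_eq_imp_iff₂, or_imp, forall_and]

theorem SymMatching.cost_le_iff {Q : Type*} {D E : Multiset (Q × WithTop Q)} (σ : SymMatching D E)
    (h : Q → ℝ) (r : ℝ≥0∞) :
    σ.cost h ≤ r ↔ (∀ x ∈ σ.pairs, symDist h x.1 x.2 ≤ r) ∧ (∀ x ∈ σ.left, symDiag h x ≤ r) ∧
      ∀ x ∈ σ.right, symDiag h x ≤ r := by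
  simp only [SymMatching.cost, max_le_iff, Multiset.sup_le, Multiset.mem_map, Multiset.mem_add,
    forall_exists_index, and_imp, forall_apply_eq_imp_iff₂, or_imp, forall_and]

section Realize

variable {Q : Type*} {h : Q → ℝ}

theorem realizeBar_eq_some {x : Q × WithTop Q} {I : Bar} (hx : realizeBar h x = some I) :
    I.birth = h x.1 ∧ I.death = x.2.map h := by
  unfold realizeBar at hx
  split_ifs at hx
  obtain rfl := Option.some_injective _ hx
  exact ⟨rfl, rfl⟩

theorem symDist_eq {x y : Q × WithTop Q} {I J : Bar} (hx : realizeBar h x = some I)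
    (hy : realizeBar h y = some J) : symDist h x y = I.dist J := by
  obtain ⟨h1, h2⟩ := realizeBar_eq_some hx
  obtain ⟨h3, h4⟩ := realizeBar_eq_some hy
  rw [symDist, Bar.dist, h1, h2, h3, h4]

theorem symDiag_eq {x : Q × WithTop Q} {I : Bar} (hx : realizeBar h x = some I) :
    symDiag h x = I.diagDist := by
  obtain ⟨h1, h2⟩ := realizeBar_eq_some hx
  rw [symDiag, Bar.diagDist, h1, h2]

theorem map_eq_of_realizeBar_eq_none {x : Q × WithTop Q} (hx : realizeBar h x = none)
    (hle : (h x.1 : WithTop ℝ) ≤ x.2.map h) : x.2.map h = (h x.1 : WithTop ℝ) := by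
  unfold realizeBar at hx
  split_ifs at hx with hlt
  exact le_antisymm (not_lt.1 hlt) hle

theorem symDiag_eq_zero {x : Q × WithTop Q} (hx : realizeBar h x = none)
    (hle : (h x.1 : WithTop ℝ) ≤ x.2.map h) : symDiag h x = 0 := by
  rw [symDiag, map_eq_of_realizeBar_eq_none hx hle]
  simp [extAbsDiff]

theorem symDist_comm (x y : Q × WithTop Q) : symDist h x y = symDist h y x := by
  rw [symDist, symDist, extAbsDiff_comm, abs_sub_comm]

/-- Matching a bar with a point of the diagonal costs at least as much as leaving it unmatched. -/
theorem symDiag_le_symDist {x y : Q × WithTop Q} (hx : realizeBar h x = none)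
    (hle : (h x.1 : WithTop ℝ) ≤ x.2.map h) : symDiag h y ≤ symDist h x y := by
  rw [symDiag, symDist, map_eq_of_realizeBar_eq_none hx hle]
  rcases hy : y.2.map h with _ | d
  · exact le_max_of_le_right le_top
  · change ENNReal.ofReal |d - h y.1| / 2 ≤ max _ (ENNReal.ofReal |h x.1 - d|)
    rw [← ENNReal.ofReal_max]
    apply ENNReal.div_le_of_le_mul
    rw [show (2 : ℝ≥0∞) = ENNReal.ofReal 2 by simp, ← ENNReal.ofReal_mul (by positivity)]
    apply ENNReal.ofReal_le_ofReal
    have h1 := le_max_left |h x.1 - h y.1| |h x.1 - d|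
    have h2 := le_max_right |h x.1 - h y.1| |h x.1 - d|
    have h3 := abs_sub_le d (h x.1) (h y.1)
    rw [abs_sub_comm d (h x.1)] at h3
    linarith

/-- A matching of realised barcodes lifts to a matching of the symbolic ones. -/
theorem exists_symMatching_lift (P : Multiset (Bar × Bar)) : ∀ (A B : Multiset Bar)
    (D E : Multiset (Q × WithTop Q)), P.map Prod.fst + A = D.filterMap (realizeBar h) →
    P.map Prod.snd + B = E.filterMap (realizeBar h) →
    ∃ σ : SymMatching D E,
      (∀ x ∈ σ.pairs, ∃ y ∈ P, realizeBar h x.1 = some y.1 ∧ realizeBar h x.2 = some y.2) ∧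
      (∀ x ∈ σ.left, realizeBar h x = none ∨ ∃ y ∈ A, realizeBar h x = some y) ∧
      ∀ x ∈ σ.right, realizeBar h x = none ∨ ∃ y ∈ B, realizeBar h x = some y := by
  induction P using Multiset.induction_on with
  | empty =>
    intro A B D E hD hE
    rw [Multiset.map_zero, zero_add] at hD hE
    have key : ∀ (A : Multiset Bar) (D : Multiset (Q × WithTop Q)),
        A = D.filterMap (realizeBar h) →
        ∀ x ∈ D, realizeBar h x = none ∨ ∃ y ∈ A, realizeBar h x = some y := by
      rintro A D rfl x hx
      rcases hr : realizeBar h x with _ | y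
      · exact Or.inl rfl
      · exact Or.inr ⟨y, (Multiset.mem_filterMap _ _).2 ⟨x, hx, hr⟩, rfl⟩
    exact ⟨⟨0, D, E, by simp, by simp⟩, by simp, key A D hD, key B E hE⟩
  | cons p P ih =>
    intro A B D E hD hE
    have key : ∀ (I : Bar) (A : Multiset Bar) (D : Multiset (Q × WithTop Q)),
        I ::ₘ A = D.filterMap (realizeBar h) → ∃ x D', D = x ::ₘ D' ∧ realizeBar h x = some I ∧
          A = D'.filterMap (realizeBar h) := by
      intro I A D hD
      have hI : I ∈ D.filterMap (realizeBar h) := hD ▸ Multiset.mem_cons_self I A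
      obtain ⟨x, hx, hxI⟩ := (Multiset.mem_filterMap _ _).1 hI
      obtain ⟨D', rfl⟩ := Multiset.exists_cons_of_mem hx
      rw [Multiset.filterMap_cons_some _ _ _ hxI, Multiset.cons_inj_right] at hD
      exact ⟨x, D', rfl, hxI, hD⟩
    rw [Multiset.map_cons, Multiset.cons_add] at hD hE
    obtain ⟨x, D', rfl, hx, hD'⟩ := key _ _ _ hD
    obtain ⟨y, E', rfl, hy, hE'⟩ := key _ _ _ hE
    obtain ⟨σ, h1, h2, h3⟩ := ih A B D' E' hD' hE'
    refine ⟨⟨(x, y) ::ₘ σ.pairs, σ.left, σ.right, ?_, ?_⟩, ?_, h2, h3⟩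
    · rw [Multiset.map_cons, Multiset.cons_add, σ.left_eq]
    · rw [Multiset.map_cons, Multiset.cons_add, σ.right_eq]
    · intro z hz
      rcases Multiset.mem_cons.1 hz with rfl | hz
      · exact ⟨p, Multiset.mem_cons_self _ _, hx, hy⟩
      · obtain ⟨q, hq, hq'⟩ := h1 z hz
        exact ⟨q, Multiset.mem_cons_of_mem hq, hq'⟩

/-- A matching of symbolic barcodes induces one of the realised barcodes, in which the partners of
the empty bars are left unmatched. -/
theorem exists_barMatching (P : Multiset ((Q × WithTop Q) × (Q × WithTop Q))) :
    ∀ (A B : Multiset (Q × WithTop Q)), ∃ σ : BarMatching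
      ((P.map Prod.fst + A).filterMap (realizeBar h))
      ((P.map Prod.snd + B).filterMap (realizeBar h)),
      (∀ y ∈ σ.pairs, ∃ x ∈ P, realizeBar h x.1 = some y.1 ∧ realizeBar h x.2 = some y.2) ∧
      (∀ y ∈ σ.left, (∃ x ∈ A, realizeBar h x = some y) ∨
        ∃ x ∈ P, realizeBar h x.1 = some y ∧ realizeBar h x.2 = none) ∧
      ∀ y ∈ σ.right, (∃ x ∈ B, realizeBar h x = some y) ∨
        ∃ x ∈ P, realizeBar h x.2 = some y ∧ realizeBar h x.1 = none := by
  intro A B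
  induction P using Multiset.induction_on with
  | empty =>
    refine ⟨⟨0, A.filterMap (realizeBar h), B.filterMap (realizeBar h), by simp, by simp⟩,
      by simp, ?_, ?_⟩ <;> exact fun y hy => Or.inl ((Multiset.mem_filterMap _ _).1 hy)
  | cons p P ih =>
    obtain ⟨σ, h1, h2, h3⟩ := ih
    have h1' : ∀ y ∈ σ.pairs, ∃ x ∈ p ::ₘ P,
        realizeBar h x.1 = some y.1 ∧ realizeBar h x.2 = some y.2 := fun y hy =>
      let ⟨x, hx, hx'⟩ := h1 y hy; ⟨x, Multiset.mem_cons_of_mem hx, hx'⟩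
    have h2' : ∀ y ∈ σ.left, (∃ x ∈ A, realizeBar h x = some y) ∨
        ∃ x ∈ p ::ₘ P, realizeBar h x.1 = some y ∧ realizeBar h x.2 = none := fun y hy =>
      (h2 y hy).imp_right fun ⟨x, hx, hx'⟩ => ⟨x, Multiset.mem_cons_of_mem hx, hx'⟩
    have h3' : ∀ y ∈ σ.right, (∃ x ∈ B, realizeBar h x = some y) ∨
        ∃ x ∈ p ::ₘ P, realizeBar h x.2 = some y ∧ realizeBar h x.1 = none := fun y hy =>
      (h3 y hy).imp_right fun ⟨x, hx, hx'⟩ => ⟨x, Multiset.mem_cons_of_mem hx, hx'⟩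
    rw [Multiset.map_cons, Multiset.map_cons, Multiset.cons_add, Multiset.cons_add]
    have hp : p ∈ p ::ₘ P := Multiset.mem_cons_self _ _
    rcases hx : realizeBar h p.1 with _ | I <;> rcases hy : realizeBar h p.2 with _ | J
    · rw [Multiset.filterMap_cons_none _ _ hx, Multiset.filterMap_cons_none _ _ hy]
      exact ⟨σ, h1', h2', h3'⟩
    · rw [Multiset.filterMap_cons_none _ _ hx, Multiset.filterMap_cons_some _ _ _ hy]
      refine ⟨⟨σ.pairs, σ.left, J ::ₘ σ.right, σ.left_eq, ?_⟩, h1', h2', ?_⟩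
      · rw [Multiset.add_cons, σ.right_eq]
      · intro y hy'
        rcases Multiset.mem_cons.1 hy' with rfl | hy'
        · exact Or.inr ⟨p, hp, hy, hx⟩
        · exact h3' y hy'
    · rw [Multiset.filterMap_cons_some _ _ _ hx, Multiset.filterMap_cons_none _ _ hy]
      refine ⟨⟨σ.pairs, I ::ₘ σ.left, σ.right, ?_, σ.right_eq⟩, h1', ?_, h3'⟩
      · rw [Multiset.add_cons, σ.left_eq]
      · intro y hy'
        rcases Multiset.mem_cons.1 hy' with rfl | hy'
        · exact Or.inr ⟨p, hp, hx, hy⟩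
        · exact h2' y hy'
    · rw [Multiset.filterMap_cons_some _ _ _ hx, Multiset.filterMap_cons_some _ _ _ hy]
      refine ⟨⟨(I, J) ::ₘ σ.pairs, σ.left, σ.right, ?_, ?_⟩, ?_, h2', h3'⟩
      · rw [Multiset.map_cons, Multiset.cons_add, σ.left_eq]
      · rw [Multiset.map_cons, Multiset.cons_add, σ.right_eq]
      · intro y hy'
        rcases Multiset.mem_cons.1 hy' with rfl | hy'
        · exact ⟨p, hp, hx, hy⟩
        · exact h1' y hy'

/-- Empty bars do not change the bottleneck distance. -/
theorem bottleneckDist_realize {D E : Multiset (Q × WithTop Q)}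
    (hD : ∀ x ∈ D, (h x.1 : WithTop ℝ) ≤ x.2.map h)
    (hE : ∀ x ∈ E, (h x.1 : WithTop ℝ) ≤ x.2.map h) :
    bottleneckDist (D.filterMap (realizeBar h)) (E.filterMap (realizeBar h)) =
      symBottleneck h D E := by
  apply le_antisymm
  · refine le_iInf fun σ => ?_
    obtain ⟨P, A, B, rfl, rfl⟩ := σ
    obtain ⟨τ, h1, h2, h3⟩ := exists_barMatching (h := h) P A B
    refine (iInf_le _ τ).trans ?_
    obtain ⟨c1, c2, c3⟩ := (SymMatching.cost_le_iff ⟨P, A, B, rfl, rfl⟩ h _).1 le_rfl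
    have hD' : ∀ x ∈ P, (h x.1.1 : WithTop ℝ) ≤ x.1.2.map h := fun x hx =>
      hD x.1 (Multiset.mem_add.2 (Or.inl (Multiset.mem_map_of_mem _ hx)))
    have hE' : ∀ x ∈ P, (h x.2.1 : WithTop ℝ) ≤ x.2.2.map h := fun x hx =>
      hE x.2 (Multiset.mem_add.2 (Or.inl (Multiset.mem_map_of_mem _ hx)))
    rw [BarMatching.cost_le_iff]
    refine ⟨fun y hy => ?_, fun y hy => ?_, fun y hy => ?_⟩
    · obtain ⟨x, hx, hx1, hx2⟩ := h1 y hy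
      rw [← symDist_eq hx1 hx2]
      exact c1 x hx
    · rcases h2 y hy with ⟨x, hx, hxy⟩ | ⟨x, hx, hxy, hn⟩
      · rw [← symDiag_eq hxy]
        exact c2 x hx
      · rw [← symDiag_eq hxy]
        refine le_trans ?_ (c1 x hx)
        rw [symDist_comm]
        exact symDiag_le_symDist hn (hE' x hx)
    · rcases h3 y hy with ⟨x, hx, hxy⟩ | ⟨x, hx, hxy, hn⟩
      · rw [← symDiag_eq hxy]
        exact c3 x hx
      · rw [← symDiag_eq hxy]
        exact (symDiag_le_symDist hn (hD' x hx)).trans (c1 x hx)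
  · refine le_iInf fun τ => ?_
    obtain ⟨σ, h1, h2, h3⟩ :=
      exists_symMatching_lift τ.pairs τ.left τ.right D E τ.left_eq τ.right_eq
    refine (iInf_le _ σ).trans ?_
    obtain ⟨c1, c2, c3⟩ := (τ.cost_le_iff _).1 le_rfl
    rw [SymMatching.cost_le_iff]
    refine ⟨fun x hx => ?_, fun x hx => ?_, fun x hx => ?_⟩
    · obtain ⟨y, hy, hy1, hy2⟩ := h1 x hx
      rw [symDist_eq hy1 hy2]
      exact c1 y hy
    · rcases h2 x hx with hn | ⟨y, hy, hxy⟩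
      · rw [symDiag_eq_zero hn]
        · exact zero_le
        · refine hD x ?_
          rw [← σ.left_eq]
          exact Multiset.mem_add.2 (Or.inr hx)
      · rw [symDiag_eq hxy]
        exact c2 y hy
    · rcases h3 x hx with hn | ⟨y, hy, hxy⟩
      · rw [symDiag_eq_zero hn]
        · exact zero_le
        · refine hE x ?_
          rw [← σ.right_eq]
          exact Multiset.mem_add.2 (Or.inr hx)
      · rw [symDiag_eq hxy]
        exact c3 y hy

end Realize

/-- The ends of the symbolic bars of `D` lie in `C`. -/
def EndsIn {Q : Type*} (C : Set Q) (D : Multiset (Q × WithTop Q)) : Prop :=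
  ∀ x ∈ D, x.1 ∈ C ∧ ∀ y : Q, x.2 = y → y ∈ C

section Compare

variable {Q : Type*} {C : Set Q}

theorem SymMatching.endsIn {D E : Multiset (Q × WithTop Q)} (hD : EndsIn C D) (hE : EndsIn C E)
    (σ : SymMatching D E) :
    (∀ x ∈ σ.pairs, (x.1.1 ∈ C ∧ ∀ y : Q, x.1.2 = y → y ∈ C) ∧
      (x.2.1 ∈ C ∧ ∀ y : Q, x.2.2 = y → y ∈ C)) ∧
    ∀ x ∈ σ.left + σ.right, x.1 ∈ C ∧ ∀ y : Q, x.2 = y → y ∈ C := by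
  refine ⟨fun x hx => ⟨hD x.1 ?_, hE x.2 ?_⟩, fun x hx => ?_⟩
  · rw [← σ.left_eq]
    exact Multiset.mem_add.2 (Or.inl (Multiset.mem_map_of_mem _ hx))
  · rw [← σ.right_eq]
    exact Multiset.mem_add.2 (Or.inl (Multiset.mem_map_of_mem _ hx))
  · rcases Multiset.mem_add.1 hx with hx | hx
    · refine hD x ?_
      rw [← σ.left_eq]
      exact Multiset.mem_add.2 (Or.inr hx)
    · refine hE x ?_
      rw [← σ.right_eq]
      exact Multiset.mem_add.2 (Or.inr hx)

/-- If `h'` contracts all distances by the factor `c`, relative to `h`, it does so with the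
bottleneck distance. -/
theorem symBottleneck_le {D E : Multiset (Q × WithTop Q)} (hD : EndsIn C D) (hE : EndsIn C E)
    {h h' : Q → ℝ} {c : ℝ} (hc : 0 < c)
    (hle : ∀ x ∈ C, ∀ y ∈ C, |h' x - h' y| ≤ c * |h x - h y|) :
    symBottleneck h' D E ≤ ENNReal.ofReal c * symBottleneck h D E := by
  have hc0 : ENNReal.ofReal c ≠ 0 := by simpa using hc
  rw [symBottleneck, symBottleneck, ENNReal.mul_iInf_of_ne hc0 ENNReal.ofReal_ne_top]
  refine le_iInf fun σ => (iInf_le _ σ).trans ?_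
  obtain ⟨hp, hl⟩ := σ.endsIn hD hE
  obtain ⟨c1, c2, c3⟩ := (σ.cost_le_iff h _).1 le_rfl
  have hreal : ∀ x ∈ C, ∀ y ∈ C,
      ENNReal.ofReal |h' x - h' y| ≤ ENNReal.ofReal c * ENNReal.ofReal |h x - h y| := by
    intro x hx y hy
    rw [← ENNReal.ofReal_mul hc.le]
    exact ENNReal.ofReal_le_ofReal (hle x hx y hy)
  have hext : ∀ x y : WithTop Q, (∀ z : Q, x = z → z ∈ C) → (∀ z : Q, y = z → z ∈ C) →
      extAbsDiff (x.map h') (y.map h') ≤ ENNReal.ofReal c * extAbsDiff (x.map h) (y.map h) := by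
    intro x y hx hy
    rcases x with _ | x <;> rcases y with _ | y
    · simp [extAbsDiff, WithTop.map]
    · simp [extAbsDiff, WithTop.map, ENNReal.mul_top hc0]
    · simp [extAbsDiff, WithTop.map, ENNReal.mul_top hc0]
    · exact hreal x (hx x rfl) y (hy y rfl)
  have hdiag : ∀ x ∈ σ.left + σ.right, symDiag h' x ≤ ENNReal.ofReal c * symDiag h x := by
    intro x hx
    rw [symDiag, symDiag, ← mul_div_assoc]
    refine ENNReal.div_le_div_right (hext x.2 x.1 (hl x hx).2 fun z hz => ?_) _
    rw [← WithTop.coe_injective hz]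
    exact (hl x hx).1
  rw [SymMatching.cost_le_iff]
  refine ⟨fun x hx => ?_, fun x hx => ?_, fun x hx => ?_⟩
  · refine le_trans ?_ (mul_le_mul_right (c1 x hx) _)
    rw [symDist, symDist]
    refine max_le ((hreal _ (hp x hx).1.1 _ (hp x hx).2.1).trans ?_)
      ((hext _ _ (hp x hx).1.2 (hp x hx).2.2).trans ?_)
    · exact mul_le_mul_right (le_max_left _ _) _
    · exact mul_le_mul_right (le_max_right _ _) _
  · exact (hdiag x (Multiset.mem_add.2 (Or.inl hx))).trans (mul_le_mul_right (c2 x hx) _)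
  · exact (hdiag x (Multiset.mem_add.2 (Or.inr hx))).trans (mul_le_mul_right (c3 x hx) _)

end Compare

/-! ### Finite chains of cost functions -/

section Chain

variable {X : Type*} {A : Set (X → ℝ≥0∞)}

theorem IsChain.sup_mem (hA : IsChain (· ≤ ·) A) {f g : X → ℝ≥0∞} (hf : f ∈ A) (hg : g ∈ A) :
    (fun x => max (f x) (g x)) ∈ A := by
  rcases hA.total hf hg with h | h
  · rwa [show (fun x => max (f x) (g x)) = g from funext fun x => max_eq_right (h x)]
  · rwa [show (fun x => max (f x) (g x)) = f from funext fun x => max_eq_left (h x)]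

theorem IsChain.multiset_sup_mem (hA : IsChain (· ≤ ·) A) (h0 : (fun _ => 0) ∈ A) {ι : Type*}
    (s : Multiset ι) (f : ι → X → ℝ≥0∞) (hf : ∀ i ∈ s, f i ∈ A) :
    (fun x => (s.map fun i => f i x).sup) ∈ A := by
  induction s using Multiset.induction_on with
  | empty => simpa using h0
  | cons i s ih =>
    simp only [Multiset.map_cons, Multiset.sup_cons]
    exact hA.sup_mem (hf i (Multiset.mem_cons_self _ _))
      (ih fun j hj => hf j (Multiset.mem_cons_of_mem hj))

theorem IsChain.iInf_mem (hA : IsChain (· ≤ ·) A) (hfin : A.Finite) {ι : Type*} [Nonempty ι]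
    (f : ι → X → ℝ≥0∞) (hf : ∀ i, f i ∈ A) : (fun x => ⨅ i, f i x) ∈ A := by
  obtain ⟨g, ⟨i, rfl⟩, hmin⟩ := (hfin.subset (Set.range_subset_iff.2 hf)).exists_minimal
    (Set.range_nonempty f)
  have : (fun x => ⨅ i, f i x) = f i := by
    funext x
    refine le_antisymm (iInf_le _ i) (le_iInf fun j => ?_)
    rcases hA.total (hf i) (hf j) with h | h
    · exact h x
    · exact hmin ⟨j, rfl⟩ h x
  rw [this]
  exact hf i

end Chain

/-- The costs of matching and leaving unmatched bars with ends in `C` along a family `h` of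
realisations, as functions of the parameter of the family. -/
def costFunctions {Q X : Type*} (C : Set Q) (h : X → Q → ℝ) : Set (X → ℝ≥0∞) :=
  {fun _ => 0, fun _ => ⊤} ∪
    (fun p : (Q × Q) × ℝ => fun t => ENNReal.ofReal (|h t p.1.1 - h t p.1.2| / p.2)) ''
      ((C ×ˢ C) ×ˢ {1, 2})

theorem costFunctions_finite {Q X : Type*} {C : Set Q} (hC : C.Finite) (h : X → Q → ℝ) :
    (costFunctions C h).Finite :=
  (Set.toFinite _).union (((hC.prod hC).prod (Set.toFinite _)).image _)

/-- If the cost functions are linearly ordered, the bottleneck distance is one of them. -/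
theorem symBottleneck_mem_costFunctions {Q X : Type*} {C : Set Q} (hC : C.Finite) {h : X → Q → ℝ}
    (hchain : IsChain (· ≤ ·) (costFunctions C h)) {D E : Multiset (Q × WithTop Q)}
    (hD : EndsIn C D) (hE : EndsIn C E) :
    (fun t => symBottleneck (h t) D E) ∈ costFunctions C h := by
  have h0 : (fun _ => 0) ∈ costFunctions C h := Or.inl (Or.inl rfl)
  have hreal : ∀ x ∈ C, ∀ y ∈ C,
      (fun t => ENNReal.ofReal |h t x - h t y|) ∈ costFunctions C h := by
    intro x hx y hy
    refine Or.inr ⟨((x, y), 1), ⟨⟨hx, hy⟩, Or.inl rfl⟩, ?_⟩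
    simp
  have hext : ∀ x y : WithTop Q, (∀ z : Q, x = z → z ∈ C) → (∀ z : Q, y = z → z ∈ C) →
      (fun t => extAbsDiff (x.map (h t)) (y.map (h t))) ∈ costFunctions C h := by
    intro x y hx hy
    rcases x with _ | x <;> rcases y with _ | y
    · exact h0
    · exact Or.inl (Or.inr rfl)
    · exact Or.inl (Or.inr rfl)
    · exact hreal x (hx x rfl) y (hy y rfl)
  have hdist : ∀ x y : Q × WithTop Q, (x.1 ∈ C ∧ ∀ z : Q, x.2 = z → z ∈ C) →
      (y.1 ∈ C ∧ ∀ z : Q, y.2 = z → z ∈ C) →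
      (fun t => symDist (h t) x y) ∈ costFunctions C h := fun x y hx hy =>
    hchain.sup_mem (hreal _ hx.1 _ hy.1) (hext _ _ hx.2 hy.2)
  have hdiag : ∀ x : Q × WithTop Q, (x.1 ∈ C ∧ ∀ z : Q, x.2 = z → z ∈ C) →
      (fun t => symDiag (h t) x) ∈ costFunctions C h := by
    rintro ⟨x, d⟩ ⟨hx, hd⟩
    rcases d with _ | y
    · refine Or.inl (Or.inr (funext fun t => ?_))
      simp [symDiag, extAbsDiff, WithTop.map, ENNReal.top_div_of_ne_top]
    · refine Or.inr ⟨((y, x), 2), ⟨⟨hd y rfl, hx⟩, Or.inr rfl⟩, funext fun t => ?_⟩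
      change ENNReal.ofReal (|h t y - h t x| / 2) = ENNReal.ofReal |h t y - h t x| / 2
      rw [ENNReal.ofReal_div_of_pos two_pos]
      simp
  refine hchain.iInf_mem (costFunctions_finite hC h) (fun σ t => SymMatching.cost σ (h t))
    fun σ => ?_
  obtain ⟨hp, hl⟩ := σ.endsIn hD hE
  exact hchain.sup_mem
    (hchain.multiset_sup_mem h0 σ.pairs (fun x t => symDist (h t) x.1 x.2)
      fun x hx => hdist _ _ (hp x hx).1 (hp x hx).2)
    (hchain.multiset_sup_mem h0 (σ.left + σ.right) (fun x t => symDiag (h t) x)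
      fun x hx => hdiag x (hl x hx))

/-! ### The bottleneck distance along a sup-homomorphism -/

/-- The persistence diagram of a module with finitely many critical values along a curve that
enters the cone above each critical value `x` at the parameter `h x`. -/
def IsCriticalSet.fiberDgm {F : Type u} [Field F] {M : PersistenceModule.{u, v} F (Fin 2 → ℝ)}
    {C : Set (Fin 2 → ℝ)} (hC : IsCriticalSet M C) (h : SupHom (Fin 2 → ℝ) ℝ) : Multiset Bar :=
  dgm (M.comap _ (exists_monotone_curve hC.1.supClosure supClosed_supClosure h).choose_spec.1)

theorem IsCriticalSet.exists_fiberDgm_eq {F : Type u} [Field F]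
    {M : PersistenceModule.{u, v} F (Fin 2 → ℝ)} (hM : M.PointwiseFinite) {C : Set (Fin 2 → ℝ)}
    (hC : IsCriticalSet M C) (h₀ : SupHom (Fin 2 → ℝ) ℝ) :
    ∃ D : Multiset ((Fin 2 → ℝ) × WithTop (Fin 2 → ℝ)), EndsIn (supClosure C) D ∧
      ∀ h : SupHom (Fin 2 → ℝ) ℝ,
        (∀ x ∈ supClosure C, ∀ y ∈ supClosure C, h₀ x ≤ h₀ y → h x ≤ h y) →
        (∀ x ∈ D, (h x.1 : WithTop ℝ) ≤ x.2.map h) ∧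
          hC.fiberDgm h = D.filterMap (realizeBar h) := by
  obtain ⟨D, hD, hD'⟩ := hC.exists_symbolic_barcode hM h₀
  refine ⟨D, hD, fun h hh => ⟨(hD' h hh).1, (hD' h hh).2 _ _ ?_⟩⟩
  exact (exists_monotone_curve hC.1.supClosure supClosed_supClosure h).choose_spec.2

theorem IsCriticalSet.dgm_comap {F : Type u} [Field F]
    {M : PersistenceModule.{u, v} F (Fin 2 → ℝ)} (hM : M.PointwiseFinite) {C : Set (Fin 2 → ℝ)}
    (hC : IsCriticalSet M C) (h : SupHom (Fin 2 → ℝ) ℝ) {γ : ℝ → Fin 2 → ℝ} (hγ : Monotone γ)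
    (hγh : ∀ x ∈ supClosure C, ∀ s, x ≤ γ s ↔ h x ≤ s) :
    dgm (M.comap γ hγ) = hC.fiberDgm h := by
  obtain ⟨D, hD, hD'⟩ := hC.exists_symbolic_barcode hM h
  rw [(hD' h fun _ _ _ _ h => h).2 γ hγ hγh]
  refine ((hD' h fun _ _ _ _ h => h).2 _ _ ?_).symm
  exact (exists_monotone_curve hC.1.supClosure supClosed_supClosure h).choose_spec.2

theorem EndsIn.mono {Q : Type*} {C C' : Set Q} {D : Multiset (Q × WithTop Q)} (h : EndsIn C D)
    (hC : C ⊆ C') : EndsIn C' D := fun x hx =>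
  ⟨hC (h x hx).1, fun y hy => hC ((h x hx).2 y hy)⟩

section Fiber

variable {F : Type u} [Field F] {M : PersistenceModule.{u, v} F (Fin 2 → ℝ)}
  {N : PersistenceModule.{u, w} F (Fin 2 → ℝ)} {A B : Set (Fin 2 → ℝ)}

/-- The bottleneck distance of two modules along a curve that enters the cones above the critical
values at the parameters given by `h`. -/
def fiberDist (hA : IsCriticalSet M A) (hB : IsCriticalSet N B) (h : SupHom (Fin 2 → ℝ) ℝ) :
    ℝ≥0∞ :=
  bottleneckDist (hA.fiberDgm h) (hB.fiberDgm h)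

theorem exists_fiberDist_eq (hM : M.PointwiseFinite) (hN : N.PointwiseFinite)
    (hA : IsCriticalSet M A) (hB : IsCriticalSet N B) (h₀ : SupHom (Fin 2 → ℝ) ℝ) :
    ∃ D E : Multiset ((Fin 2 → ℝ) × WithTop (Fin 2 → ℝ)),
      EndsIn (supClosure A ∪ supClosure B) D ∧ EndsIn (supClosure A ∪ supClosure B) E ∧
      ∀ h : SupHom (Fin 2 → ℝ) ℝ,
        (∀ x ∈ supClosure A, ∀ y ∈ supClosure A, h₀ x ≤ h₀ y → h x ≤ h y) →
        (∀ x ∈ supClosure B, ∀ y ∈ supClosure B, h₀ x ≤ h₀ y → h x ≤ h y) →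
        fiberDist hA hB h = symBottleneck h D E := by
  obtain ⟨D, hD, hD'⟩ := hA.exists_fiberDgm_eq hM h₀
  obtain ⟨E, hE, hE'⟩ := hB.exists_fiberDgm_eq hN h₀
  refine ⟨D, E, hD.mono Set.subset_union_left, hE.mono Set.subset_union_right,
    fun h h1 h2 => ?_⟩
  rw [fiberDist, (hD' h h1).2, (hE' h h2).2, bottleneckDist_realize (hD' h h1).1 (hE' h h2).1]

theorem fiberDist_le (hM : M.PointwiseFinite) (hN : N.PointwiseFinite)
    (hA : IsCriticalSet M A) (hB : IsCriticalSet N B) {h h' : SupHom (Fin 2 → ℝ) ℝ} {c : ℝ}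
    (hc : 0 < c)
    (hord : ∀ x ∈ supClosure A ∪ supClosure B, ∀ y ∈ supClosure A ∪ supClosure B,
      h x ≤ h y → h' x ≤ h' y)
    (hle : ∀ x ∈ supClosure A ∪ supClosure B, ∀ y ∈ supClosure A ∪ supClosure B,
      |h' x - h' y| ≤ c * |h x - h y|) :
    fiberDist hA hB h' ≤ ENNReal.ofReal c * fiberDist hA hB h := by
  obtain ⟨D, E, hD, hE, hDE⟩ := exists_fiberDist_eq hM hN hA hB h
  rw [hDE h (fun _ _ _ _ h => h) (fun _ _ _ _ h => h),
    hDE h' (fun x hx y hy => hord x (Or.inl hx) y (Or.inl hy))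
      (fun x hx y hy => hord x (Or.inr hx) y (Or.inr hy))]
  exact symBottleneck_le hD hE hc hle

/-- The bottleneck distance is invariant under translations of the parameter. -/
theorem fiberDist_eq_of_add (hM : M.PointwiseFinite) (hN : N.PointwiseFinite)
    (hA : IsCriticalSet M A) (hB : IsCriticalSet N B) {h h' : SupHom (Fin 2 → ℝ) ℝ} (κ : ℝ)
    (heq : ∀ x ∈ supClosure A ∪ supClosure B, h' x = h x + κ) :
    fiberDist hA hB h' = fiberDist hA hB h := by
  apply le_antisymm
  · rw [← one_mul (fiberDist hA hB h), ← ENNReal.ofReal_one]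
    refine fiberDist_le hM hN hA hB one_pos (fun x hx y hy hxy => ?_) fun x hx y hy => ?_
    · rw [heq x hx, heq y hy]; linarith
    · rw [heq x hx, heq y hy]; simp
  · rw [← one_mul (fiberDist hA hB h'), ← ENNReal.ofReal_one]
    refine fiberDist_le hM hN hA hB one_pos (fun x hx y hy hxy => ?_) fun x hx y hy => ?_
    · rw [heq x hx, heq y hy] at hxy; linarith
    · rw [heq x hx, heq y hy]; simp

/-- The push onto a line as a sup-homomorphism. -/
def PosLine.pushHom (L : PosLine) : SupHom (Fin 2 → ℝ) ℝ where
  toFun := L.pushParam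
  map_sup' x y := by
    refine eq_of_forall_ge_iff fun s => ?_
    rw [← L.le_point_iff, sup_le_iff, sup_le_iff, L.le_point_iff, L.le_point_iff]

theorem PosLine.weight_pos (L : PosLine) : 0 < L.weight := lt_min (L.m_pos 0) (L.m_pos 1)

/-- The weighted bottleneck distance along a line is the bottleneck distance after rescaling the
parameter of the line by its weight. -/
theorem weightedBottleneck_eq_fiberDist (hM : M.PointwiseFinite) (hN : N.PointwiseFinite)
    (hA : IsCriticalSet M A) (hB : IsCriticalSet N B) (L : PosLine) (h : SupHom (Fin 2 → ℝ) ℝ)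
    (κ : ℝ) (heq : ∀ x, h x = L.weight * L.pushParam x + κ) :
    weightedBottleneck M N L = fiberDist hA hB h := by
  have hw := L.weight_pos
  have h1 : dgm (M.restrict L) = hA.fiberDgm L.pushHom :=
    hA.dgm_comap hM L.pushHom L.point_mono fun x _ s => L.le_point_iff x s
  have h2 : dgm (N.restrict L) = hB.fiberDgm L.pushHom :=
    hB.dgm_comap hN L.pushHom L.point_mono fun x _ s => L.le_point_iff x s
  have h3 : weightedBottleneck M N L = ENNReal.ofReal L.weight * fiberDist hA hB L.pushHom := by
    rw [weightedBottleneck, h1, h2, fiberDist]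
  have hp : ∀ x, L.pushHom x = L.pushParam x := fun _ => rfl
  have habs : ∀ x y, |h x - h y| = L.weight * |L.pushParam x - L.pushParam y| := by
    intro x y
    rw [heq, heq, add_sub_add_right_eq_sub, ← mul_sub, abs_mul, abs_of_pos hw]
  rw [h3]
  apply le_antisymm
  · have hw0 : ENNReal.ofReal L.weight ≠ 0 := by simpa using hw
    have h4 : fiberDist hA hB L.pushHom ≤
        ENNReal.ofReal L.weight⁻¹ * fiberDist hA hB h := by
      refine fiberDist_le hM hN hA hB (inv_pos.2 hw) (fun x _ y _ hxy => ?_) fun x _ y _ => ?_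
      · rw [heq, heq] at hxy
        rw [hp, hp]
        exact le_of_mul_le_mul_left (by linarith) hw
      · rw [hp, hp, habs, inv_mul_cancel_left₀ hw.ne']
    refine (mul_le_mul_right h4 _).trans ?_
    rw [← mul_assoc, ENNReal.ofReal_inv_of_pos hw, ENNReal.mul_inv_cancel hw0 ENNReal.ofReal_ne_top,
      one_mul]
  · refine fiberDist_le hM hN hA hB hw (fun x _ y _ hxy => ?_) fun x _ y _ => ?_
    · rw [hp, hp] at hxy
      rw [heq, heq]
      have := mul_le_mul_of_nonneg_left hxy hw.le
      linarith
    · rw [hp, hp, habs]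

/-- A path of sup-homomorphisms along which the order of all costs is constant. The bottleneck
distance then coincides with a single cost function, so that affinity of the path bounds it by its
values at the ends. -/
theorem fiberDist_le_max (hM : M.PointwiseFinite) (hN : N.PointwiseFinite)
    (hA : IsCriticalSet M A) (hB : IsCriticalSet N B) (h : ℝ → SupHom (Fin 2 → ℝ) ℝ) {a b t₀ : ℝ}
    (ha : a < t₀) (hb : t₀ < b)
    (hcont : ∀ x ∈ supClosure A ∪ supClosure B, Continuous fun t => h t x)
    (hcomp : ∀ t ∈ Set.Ioo a b, ∀ t' ∈ Set.Ioo a b,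
      ∀ x ∈ supClosure A ∪ supClosure B, ∀ y ∈ supClosure A ∪ supClosure B,
      ∀ z ∈ supClosure A ∪ supClosure B, ∀ w ∈ supClosure A ∪ supClosure B,
      ∀ δ ∈ ({1, 2} : Set ℝ), ∀ η ∈ ({1, 2} : Set ℝ),
      |h t x - h t y| / δ ≤ |h t z - h t w| / η → |h t' x - h t' y| / δ ≤ |h t' z - h t' w| / η)
    {lam : ℝ} (hl0 : 0 ≤ lam) (hl1 : lam ≤ 1)
    (haff : ∀ x ∈ supClosure A ∪ supClosure B, h t₀ x = (1 - lam) * h a x + lam * h b x) :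
    fiberDist hA hB (h t₀) ≤ max (fiberDist hA hB (h a)) (fiberDist hA hB (h b)) := by
  have ht₀ : t₀ ∈ Set.Ioo a b := ⟨ha, hb⟩
  have hab : a < b := ha.trans hb
  -- weak inequalities between continuous functions extend to the closed interval
  have hclos : ∀ f g : ℝ → ℝ, Continuous f → Continuous g → (∀ t ∈ Set.Ioo a b, f t ≤ g t) →
      ∀ t ∈ Set.Icc a b, f t ≤ g t := by
    intro f g hf hg hfg t ht
    rw [← closure_Ioo hab.ne] at ht
    exact closure_minimal (t := {t | f t ≤ g t}) hfg (isClosed_le hf hg) ht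
  have hord : ∀ C' ⊆ supClosure A ∪ supClosure B, SupClosed C' → ∀ t ∈ Set.Icc a b,
      ∀ x ∈ C', ∀ y ∈ C', h t₀ x ≤ h t₀ y → h t x ≤ h t y := by
    intro C' hC' hsup t ht x hx y hy hxy
    refine hclos _ _ (hcont x (hC' hx)) (hcont y (hC' hy)) (fun t ht => ?_) t ht
    have h1 := hcomp t₀ ht₀ t ht _ (hC' (hsup hx hy)) y (hC' hy) y (hC' hy) y (hC' hy)
      1 (Or.inl rfl) 1 (Or.inl rfl) (by simp [map_sup, hxy])
    simp only [map_sup, sub_self, abs_zero, div_one] at h1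
    have h2 := abs_nonpos_iff.1 h1
    exact sup_eq_right.1 (sub_eq_zero.1 h2)
  obtain ⟨D, E, hD, hE, hDE⟩ := exists_fiberDist_eq hM hN hA hB (h t₀)
  have hF : ∀ t ∈ Set.Icc a b, fiberDist hA hB (h t) = symBottleneck (h t) D E := fun t ht =>
    hDE _ (hord _ Set.subset_union_left supClosed_supClosure t ht)
      (hord _ Set.subset_union_right supClosed_supClosure t ht)
  let H : Set.Icc a b → (Fin 2 → ℝ) → ℝ := fun t => h t
  have hpos : ∀ δ ∈ ({1, 2} : Set ℝ), (0 : ℝ) < δ := by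
    rintro δ (rfl | rfl) <;> norm_num
  have hchain : IsChain (· ≤ ·) (costFunctions (supClosure A ∪ supClosure B) H) := by
    have hzero : ∀ f : Set.Icc a b → ℝ≥0∞, (fun _ => 0) ≤ f := fun f t => zero_le
    have htop : ∀ f : Set.Icc a b → ℝ≥0∞, f ≤ (fun _ => ⊤) := fun f t => le_top
    have key : ∀ x ∈ supClosure A ∪ supClosure B, ∀ y ∈ supClosure A ∪ supClosure B,
        ∀ z ∈ supClosure A ∪ supClosure B, ∀ w ∈ supClosure A ∪ supClosure B,
        ∀ δ ∈ ({1, 2} : Set ℝ), ∀ η ∈ ({1, 2} : Set ℝ),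
        |h t₀ x - h t₀ y| / δ ≤ |h t₀ z - h t₀ w| / η → ∀ t ∈ Set.Icc a b,
        |h t x - h t y| / δ ≤ |h t z - h t w| / η := by
      intro x hx y hy z hz w hw δ hδ η hη hle
      refine hclos _ _ ?_ ?_ fun t ht => hcomp t₀ ht₀ t ht x hx y hy z hz w hw δ hδ η hη hle
      · exact ((hcont x hx).sub (hcont y hy)).abs.div_const _
      · exact ((hcont z hz).sub (hcont w hw)).abs.div_const _
    rintro f ((rfl | rfl) | ⟨⟨⟨x, y⟩, δ⟩, ⟨⟨hx, hy⟩, hδ⟩, rfl⟩) g hg -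
    · exact Or.inl (hzero g)
    · exact Or.inr (htop g)
    · rcases hg with (rfl | rfl) | ⟨⟨⟨z, w⟩, η⟩, ⟨⟨hz, hw⟩, hη⟩, rfl⟩
      · exact Or.inr (hzero _)
      · exact Or.inl (htop _)
      · rcases le_total (|h t₀ x - h t₀ y| / δ) (|h t₀ z - h t₀ w| / η) with hle | hle
        · exact Or.inl fun t => ENNReal.ofReal_le_ofReal
            (key x hx y hy z hz w hw δ hδ η hη hle t t.2)
        · exact Or.inr fun t => ENNReal.ofReal_le_ofReal
            (key z hz w hw x hx y hy η hη δ hδ hle t t.2)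
  have hmem := symBottleneck_mem_costFunctions (hA.1.supClosure.union hB.1.supClosure) hchain hD hE
  have hconv : ∀ f ∈ costFunctions (supClosure A ∪ supClosure B) H,
      f ⟨t₀, ha.le, hb.le⟩ ≤ max (f ⟨a, le_rfl, hab.le⟩) (f ⟨b, hab.le, le_rfl⟩) := by
    rintro f ((rfl | rfl) | ⟨⟨⟨x, y⟩, δ⟩, ⟨⟨hx, hy⟩, hδ⟩, rfl⟩)
    · exact zero_le
    · exact le_max_left _ _
    · change ENNReal.ofReal (|h t₀ x - h t₀ y| / δ) ≤
        max (ENNReal.ofReal (|h a x - h a y| / δ)) (ENNReal.ofReal (|h b x - h b y| / δ))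
      rw [← ENNReal.ofReal_max, max_div_div_right (hpos δ hδ).le]
      refine ENNReal.ofReal_le_ofReal (div_le_div_of_nonneg_right ?_ (hpos δ hδ).le)
      have h1 := le_max_left |h a x - h a y| |h b x - h b y|
      have h2 := le_max_right |h a x - h a y| |h b x - h b y|
      have h3 : h t₀ x - h t₀ y = (1 - lam) * (h a x - h a y) + lam * (h b x - h b y) := by
        rw [haff x hx, haff y hy]; ring
      calc |h t₀ x - h t₀ y| ≤ (1 - lam) * |h a x - h a y| + lam * |h b x - h b y| := by
            rw [h3]
            refine (abs_add_le _ _).trans ?_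
            rw [abs_mul, abs_mul, abs_of_nonneg hl0, abs_of_nonneg (sub_nonneg.2 hl1)]
        _ ≤ (1 - lam) * max |h a x - h a y| |h b x - h b y| +
            lam * max |h a x - h a y| |h b x - h b y| :=
          add_le_add (mul_le_mul_of_nonneg_left h1 (sub_nonneg.2 hl1))
            (mul_le_mul_of_nonneg_left h2 hl0)
        _ = _ := by ring
  rw [hF t₀ ⟨ha.le, hb.le⟩, hF a ⟨le_rfl, hab.le⟩, hF b ⟨hab.le, le_rfl⟩]
  exact hconv _ hmem

end Fiber

/-! ### Points of the projective plane and reciprocal positions -/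

theorem properPoint_injective : Function.Injective properPoint := by
  intro u u' h
  obtain ⟨a, ha⟩ := (Projectivization.mk_eq_mk_iff' ℝ _ _ _ _).1 h
  have h0 := congrFun ha 0
  have h1 := congrFun ha 1
  have h2 := congrFun ha 2
  simp at h0 h1 h2
  subst h0
  funext k
  fin_cases k
  · simpa using h1.symm
  · simpa using h2.symm

theorem properPoint_ne_pointAtInfinity (u v : Fin 2 → ℝ) (hv : ∀ i, 0 < v i) :
    properPoint u ≠ pointAtInfinity v hv := by
  intro h
  obtain ⟨a, ha⟩ := (Projectivization.mk_eq_mk_iff' ℝ _ _ _ _).1 h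
  have h0 := congrFun ha 0
  simp at h0

theorem pointAtInfinity_eq_iff {v v' : Fin 2 → ℝ} (hv : ∀ i, 0 < v i) (hv' : ∀ i, 0 < v' i) :
    pointAtInfinity v hv = pointAtInfinity v' hv' ↔ ∃ a : ℝ, 0 < a ∧ ∀ k, v k = a * v' k := by
  constructor
  · intro h
    obtain ⟨a, ha⟩ := (Projectivization.mk_eq_mk_iff' ℝ _ _ _ _).1 h
    have h1 := congrFun ha 1
    have h2 := congrFun ha 2
    simp at h1 h2
    refine ⟨a, ?_, fun k => ?_⟩
    · have := hv 0
      rw [← h1] at this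
      exact (pos_iff_pos_of_mul_pos this).2 (hv' 0)
    · fin_cases k
      · exact h1.symm
      · exact h2.symm
  · rintro ⟨a, -, ha⟩
    refine (Projectivization.mk_eq_mk_iff' ℝ _ _ _ _).2 ⟨a, ?_⟩
    funext k
    fin_cases k <;> simp [ha]

theorem Fin.forall_fin_two_sub {p : Fin 2 → Prop} (i : Fin 2) :
    (∀ k, p k) ↔ p i ∧ p (1 - i) := by
  fin_cases i
  · exact Fin.forall_fin_two
  · exact Fin.forall_fin_two.trans and_comm

theorem mem_coneFace_iff (i : Fin 2) (A : Set (Fin 2)) (u x : Fin 2 → ℝ) :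
    x ∈ coneFace A u ↔ (i ∈ A → x i = u i) ∧ (i ∉ A → u i < x i) ∧
      (1 - i ∈ A → x (1 - i) = u (1 - i)) ∧ (1 - i ∉ A → u (1 - i) < x (1 - i)) := by
  rw [coneFace, Set.mem_ofPred_eq, Fin.forall_fin_two_sub i,
    Fin.forall_fin_two_sub (p := fun k => k ∉ A → u k < x k) i]
  tauto

/-- The graph of `t ↦ μ t + c` leaves the cone above `(p, q)` through the face on which the first
coordinate is `p` iff `a` holds, and the second is `q` iff `b` holds. -/
theorem exists_graph_mem_face_iff {μ c p q : ℝ} (hμ : 0 < μ) {a b : Prop} (hab : a ∨ b) :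
    (∃ t, (a → t = p) ∧ (¬ a → p < t) ∧ (b → μ * t + c = q) ∧ (¬ b → q < μ * t + c)) ↔
      (a ↔ q ≤ μ * p + c) ∧ (b ↔ μ * p + c ≤ q) := by
  by_cases ha : a <;> by_cases hb : b <;> simp only [ha, hb, not_true_eq_false, not_false_eq_true,
    forall_const, true_and, and_true, IsEmpty.forall_iff, true_iff, false_iff, not_le,
    exists_eq_left] at hab ⊢
  · exact ⟨fun h => ⟨h.ge, h.le⟩, fun h => le_antisymm h.2 h.1⟩
  · exact ⟨fun h => ⟨h.le, h⟩, fun h => h.2⟩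
  · constructor
    · rintro ⟨t, ht, rfl⟩
      have := mul_lt_mul_of_pos_left ht hμ
      exact ⟨by linarith, by linarith⟩
    · rintro ⟨h, -⟩
      refine ⟨(q - c) / μ, ?_, ?_⟩
      · rw [lt_div_iff₀ hμ]; linarith
      · rw [mul_div_cancel₀ _ hμ.ne']; ring
  · simp at hab

namespace PosLine

variable {L L' : PosLine} {i : Fin 2}

/-- The intercept of a line as a graph over the coordinate `i`. This is meaningful if the direction
of the line has coordinate `1` at `i`. -/
def intercept (L : PosLine) (i : Fin 2) : ℝ := L.b (1 - i) * (1 + L.m (1 - i))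

theorem b_eq_neg (L : PosLine) (i : Fin 2) : L.b i = - L.b (1 - i) := by
  have := L.b_sum
  fin_cases i
  · change L.b 0 = - L.b 1; linarith
  · change L.b 1 = - L.b 0; linarith

theorem point_apply_left (hi : L.m i = 1) (s : ℝ) : L.point s i = s + L.b i := by
  simp [point, hi]

theorem point_apply_right (hi : L.m i = 1) (s : ℝ) :
    L.point s (1 - i) = L.m (1 - i) * L.point s i + L.intercept i := by
  rw [point_apply_left hi, b_eq_neg]
  simp only [point, Pi.add_apply, Pi.smul_apply, smul_eq_mul, intercept]
  ring

theorem exists_point_eq (hi : L.m i = 1) {u : Fin 2 → ℝ}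
    (hu : u (1 - i) = L.m (1 - i) * u i + L.intercept i) : ∃ s, L.point s = u := by
  have h1 : L.point (u i - L.b i) i = u i := by rw [point_apply_left hi]; ring
  refine ⟨u i - L.b i, funext ((Fin.forall_fin_two_sub i).2 ⟨h1, ?_⟩)⟩
  rw [point_apply_right hi, h1, hu]

theorem mem_position_properPoint (hi : L.m i = 1) (u : Fin 2 → ℝ) (A : Set (Fin 2)) :
    A ∈ L.position (properPoint u) ↔ A.Nonempty ∧
      (i ∈ A ↔ u (1 - i) ≤ L.m (1 - i) * u i + L.intercept i) ∧
      (1 - i ∈ A ↔ L.m (1 - i) * u i + L.intercept i ≤ u (1 - i)) := by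
  refine and_congr_right fun hA => ?_
  have hA' : i ∈ A ∨ 1 - i ∈ A := by
    obtain ⟨k, hk⟩ := hA
    by_contra hn
    push Not at hn
    exact (Fin.forall_fin_two_sub (p := fun k => k ∉ A) i).2 hn k hk
  rw [← exists_graph_mem_face_iff (L.m_pos _) hA']
  have key : (L.projPoints ∩ projFace A (properPoint u)).Nonempty ↔
      ∃ s, L.point s ∈ coneFace A u := by
    constructor
    · rintro ⟨q, hq, ⟨u', x, hu, hx, rfl⟩ | ⟨v, x, hv, hx, hu, -, rfl⟩⟩
      · obtain rfl := properPoint_injective hu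
        rcases hq with hq | ⟨s, hs⟩
        · exact absurd hq (properPoint_ne_pointAtInfinity _ _ _)
        · obtain rfl := properPoint_injective hs
          exact ⟨s, hx⟩
      · exact absurd hu (properPoint_ne_pointAtInfinity _ _ _)
    · rintro ⟨s, hs⟩
      exact ⟨_, Or.inr ⟨s, rfl⟩, Or.inl ⟨u, _, rfl, hs, rfl⟩⟩
  rw [key]
  constructor
  · rintro ⟨s, hs⟩
    refine ⟨L.point s i, ?_⟩
    rw [← point_apply_right hi]
    exact (mem_coneFace_iff i A u _).1 hs
  · rintro ⟨t, ht⟩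
    have h1 : L.point (t - L.b i) i = t := by rw [point_apply_left hi]; ring
    refine ⟨t - L.b i, (mem_coneFace_iff i A u _).2 ?_⟩
    rw [point_apply_right hi, h1]
    exact ht

theorem mem_position_pointAtInfinity (hi : L.m i = 1) (v : Fin 2 → ℝ) (hv : ∀ k, 0 < v k)
    (A : Set (Fin 2)) :
    A ∈ L.position (pointAtInfinity v hv) ↔ A.Nonempty ∧
      (i ∈ A ↔ v (1 - i) ≤ L.m (1 - i) * v i) ∧ (1 - i ∈ A ↔ L.m (1 - i) * v i ≤ v (1 - i)) := by
  refine and_congr_right fun hA => ?_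
  have hA' : i ∈ A ∨ 1 - i ∈ A := by
    obtain ⟨k, hk⟩ := hA
    by_contra hn
    push Not at hn
    exact (Fin.forall_fin_two_sub (p := fun k => k ∉ A) i).2 hn k hk
  have h0 := exists_graph_mem_face_iff (μ := L.m (1 - i)) (c := 0) (p := v i) (q := v (1 - i))
    (L.m_pos _) hA'
  simp only [add_zero] at h0
  rw [← h0]
  have key : (L.projPoints ∩ projFace A (pointAtInfinity v hv)).Nonempty ↔
      ∃ t : ℝ, t • L.m ∈ coneFace A v := by
    constructor
    · rintro ⟨q, hq, ⟨u', x, hu, hx, rfl⟩ | ⟨v', x, hv', hx, hvv', hxA, rfl⟩⟩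
      · exact absurd hu.symm (properPoint_ne_pointAtInfinity _ _ _)
      · rcases hq with hq | ⟨s, hs⟩
        · obtain ⟨a, ha, hax⟩ := (pointAtInfinity_eq_iff _ _).1 hq
          obtain ⟨a', ha', hav⟩ := (pointAtInfinity_eq_iff _ _).1 hvv'
          refine ⟨a' * a, fun k hk => ?_, fun k hk => ?_⟩
          · simp only [Pi.smul_apply, smul_eq_mul]
            rw [mul_assoc, ← hax, hxA.1 k hk, ← hav]
          · simp only [Pi.smul_apply, smul_eq_mul]
            rw [mul_assoc, ← hax, hav]
            exact mul_lt_mul_of_pos_left (hxA.2 k hk) ha'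
        · exact absurd hs (properPoint_ne_pointAtInfinity _ _ _)
    · rintro ⟨t, ht⟩
      have hpos : ∀ k, 0 < (t • L.m) k := by
        intro k
        by_cases hk : k ∈ A
        · rw [ht.1 k hk]; exact hv k
        · exact (hv k).trans (ht.2 k hk)
      have ht0 : 0 < t := by
        have := hpos 0
        simp only [Pi.smul_apply, smul_eq_mul] at this
        exact (pos_iff_pos_of_mul_pos this).2 (L.m_pos 0)
      refine ⟨pointAtInfinity (t • L.m) hpos, Or.inl ?_, Or.inr ⟨v, _, hv, hpos, rfl, ht, rfl⟩⟩
      exact (pointAtInfinity_eq_iff _ _).2 ⟨t, ht0, fun k => rfl⟩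
  rw [key]
  refine exists_congr fun t => ?_
  rw [mem_coneFace_iff i]
  simp [hi, mul_comm]

theorem position_eq_empty (L : PosLine) {p : ProjPlane} (h1 : ∀ u, p ≠ properPoint u)
    (h2 : ∀ v hv, p ≠ pointAtInfinity v hv) : L.position p = ∅ := by
  refine Set.eq_empty_of_forall_notMem fun A hA => ?_
  obtain ⟨-, q, -, ⟨u, x, hu, -⟩ | ⟨v, x, hv, -, hp, -⟩⟩ := hA
  · exact h1 u hu
  · exact h2 v hv hp

/-- Lines are equivalent if the points of `U` lie on the same side of them. -/
theorem lineEquiv_of_sides {U : Set ProjPlane} (hi : L.m i = 1) (hi' : L'.m i = 1)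
    (hproper : ∀ u, properPoint u ∈ U →
      (u (1 - i) ≤ L.m (1 - i) * u i + L.intercept i ↔
        u (1 - i) ≤ L'.m (1 - i) * u i + L'.intercept i) ∧
      (L.m (1 - i) * u i + L.intercept i ≤ u (1 - i) ↔
        L'.m (1 - i) * u i + L'.intercept i ≤ u (1 - i)))
    (hinf : ∀ v hv, pointAtInfinity v hv ∈ U →
      (v (1 - i) ≤ L.m (1 - i) * v i ↔ v (1 - i) ≤ L'.m (1 - i) * v i) ∧
      (L.m (1 - i) * v i ≤ v (1 - i) ↔ L'.m (1 - i) * v i ≤ v (1 - i))) :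
    LineEquiv U L L' := by
  intro p hp
  by_cases h1 : ∃ u, p = properPoint u
  · obtain ⟨u, rfl⟩ := h1
    ext A
    rw [mem_position_properPoint hi, mem_position_properPoint hi', (hproper u hp).1,
      (hproper u hp).2]
  by_cases h2 : ∃ v hv, p = pointAtInfinity v hv
  · obtain ⟨v, hv, rfl⟩ := h2
    ext A
    rw [mem_position_pointAtInfinity hi, mem_position_pointAtInfinity hi', (hinf v hv hp).1,
      (hinf v hv hp).2]
  push Not at h1 h2
  rw [position_eq_empty L h1 h2, position_eq_empty L' h1 h2]

/-- The line that is the graph of `t ↦ μ t + c` over the coordinate `i`. -/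
def ofGraph (i : Fin 2) {μ : ℝ} (c : ℝ) (h0 : 0 < μ) (h1 : μ ≤ 1) : PosLine where
  m k := if k = i then 1 else μ
  b k := if k = i then -(c / (1 + μ)) else c / (1 + μ)
  m_pos k := by split_ifs <;> [exact one_pos; exact h0]
  m_max := by fin_cases i <;> simp [h1]
  b_sum := by fin_cases i <;> simp

theorem sub_ne (i : Fin 2) : 1 - i ≠ i := by fin_cases i <;> decide

theorem ofGraph_m_left {μ c : ℝ} (h0 : 0 < μ) (h1 : μ ≤ 1) : (ofGraph i c h0 h1).m i = 1 :=
  if_pos rfl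

theorem ofGraph_m_right {μ c : ℝ} (h0 : 0 < μ) (h1 : μ ≤ 1) :
    (ofGraph i c h0 h1).m (1 - i) = μ :=
  if_neg (sub_ne i)

theorem ofGraph_intercept {μ c : ℝ} (h0 : 0 < μ) (h1 : μ ≤ 1) :
    (ofGraph i c h0 h1).intercept i = c := by
  have hb : (ofGraph i c h0 h1).b (1 - i) = c / (1 + μ) := if_neg (sub_ne i)
  rw [intercept, hb, ofGraph_m_right h0 h1]
  field_simp

end PosLine

/-- The sup-homomorphism that describes the graph of `t ↦ μ t + c` over the coordinate `i`, for
slopes `0 ≤ μ ≤ 1`: a point is pushed onto the graph and read off in the other coordinate. For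
`μ = 0` this is the limit of lines that become parallel to the axis. Negative slopes are treated
as zero. -/
def graphHom (i : Fin 2) (μ c : ℝ) : SupHom (Fin 2 → ℝ) ℝ where
  toFun u := max (max μ 0 * u i + c) (u (1 - i))
  map_sup' x y := by
    have h : max μ 0 * (x i ⊔ y i) + c = max (max μ 0 * x i + c) (max μ 0 * y i + c) := by
      rw [max_add_add_right, ← mul_max_of_nonneg _ _ (le_max_right _ _)]
    simp only [Pi.sup_apply]
    rw [h]
    exact sup_sup_sup_comm _ _ _ _

theorem graphHom_apply {i : Fin 2} {μ : ℝ} (hμ : 0 ≤ μ) (c : ℝ) (u : Fin 2 → ℝ) :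
    graphHom i μ c u = max (μ * u i + c) (u (1 - i)) := by
  change max (max μ 0 * u i + c) (u (1 - i)) = _
  rw [max_eq_left hμ]

theorem PosLine.graphHom_eq {L : PosLine} {i : Fin 2} (hi : L.m i = 1) (u : Fin 2 → ℝ) :
    graphHom i (L.m (1 - i)) (L.intercept i) u = L.weight * L.pushParam u + L.b (1 - i) := by
  have hpos := L.m_pos (1 - i)
  have hle : L.m (1 - i) ≤ 1 := by
    rw [← L.m_max]
    fin_cases i <;> [exact le_max_right _ _; exact le_max_left _ _]
  have hw : L.weight = L.m (1 - i) := by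
    rw [weight]
    fin_cases i
    · change min (L.m 0) (L.m 1) = L.m 1
      exact min_eq_right (by rw [show L.m 0 = 1 from hi]; exact hle)
    · change min (L.m 0) (L.m 1) = L.m 0
      exact min_eq_left (by rw [show L.m 1 = 1 from hi]; exact hle)
  have hp : L.pushParam u =
      max ((u i - L.b i) / L.m i) ((u (1 - i) - L.b (1 - i)) / L.m (1 - i)) := by
    rw [pushParam]
    fin_cases i
    · rfl
    · exact max_comm _ _
  rw [graphHom_apply hpos.le, hw, hp, hi, mul_max_of_nonneg _ _ hpos.le,
    mul_div_cancel₀ _ hpos.ne', ← max_add_add_right, L.b_eq_neg i, intercept]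
  congr 1 <;> ring

theorem PosLine.exists_m_eq_one (L : PosLine) : ∃ i, L.m i = 1 ∧ L.m (1 - i) ≤ 1 := by
  rcases max_choice (L.m 0) (L.m 1) with h | h
  · rw [L.m_max] at h
    exact ⟨0, h.symm, by rw [← L.m_max]; exact le_max_right _ _⟩
  · rw [L.m_max] at h
    exact ⟨1, h.symm, by rw [← L.m_max]; exact le_max_left _ _⟩

/-! ### Signs of continuous functions on intervals -/

/-- A continuous function without zeros on an interval, or vanishing on it, keeps its sign. -/
theorem nonneg_of_nonneg_of_Ioo {f : ℝ → ℝ} (hf : Continuous f) {a b : ℝ}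
    (h : (∀ t ∈ Set.Ioo a b, f t ≠ 0) ∨ ∀ t ∈ Set.Ioo a b, f t = 0) {t t' : ℝ}
    (ht : t ∈ Set.Ioo a b) (ht' : t' ∈ Set.Ioo a b) (h0 : 0 ≤ f t) : 0 ≤ f t' := by
  rcases h with h | h
  · by_contra hlt
    push Not at hlt
    obtain ⟨r, hr, hr0⟩ := intermediate_value_uIcc hf.continuousOn
      (Set.mem_uIcc.2 (Or.inr ⟨hlt.le, h0⟩))
    exact h r (Set.ordConnected_Ioo.uIcc_subset ht ht' hr) hr0
  · exact (h t' ht').ge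

theorem sides_iff_of_Ioo {f g : ℝ → ℝ} (hf : Continuous f) (hg : Continuous g) {a b : ℝ}
    (h : (∀ t ∈ Set.Ioo a b, f t ≠ g t) ∨ ∀ t ∈ Set.Ioo a b, f t = g t) {t t' : ℝ}
    (ht : t ∈ Set.Ioo a b) (ht' : t' ∈ Set.Ioo a b) :
    (g t ≤ f t ↔ g t' ≤ f t') ∧ (f t ≤ g t ↔ f t' ≤ g t') := by
  have h1 : (∀ t ∈ Set.Ioo a b, f t - g t ≠ 0) ∨ ∀ t ∈ Set.Ioo a b, f t - g t = 0 := by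
    simpa only [sub_ne_zero, sub_eq_zero] using h
  have h2 : (∀ t ∈ Set.Ioo a b, g t - f t ≠ 0) ∨ ∀ t ∈ Set.Ioo a b, g t - f t = 0 := by
    simpa only [sub_ne_zero, sub_eq_zero, ne_comm, eq_comm] using h
  constructor
  · rw [← sub_nonneg, ← sub_nonneg (b := g t')]
    exact ⟨nonneg_of_nonneg_of_Ioo (hf.sub hg) h1 ht ht',
      nonneg_of_nonneg_of_Ioo (hf.sub hg) h1 ht' ht⟩
  · rw [← sub_nonneg, ← sub_nonneg (b := f t')]
    exact ⟨nonneg_of_nonneg_of_Ioo (hg.sub hf) h2 ht ht',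
      nonneg_of_nonneg_of_Ioo (hg.sub hf) h2 ht' ht⟩

/-! ### Moving lines -/

section Moves

variable {F : Type u} [Field F] {M : PersistenceModule.{u, v} F (Fin 2 → ℝ)}
  {N : PersistenceModule.{u, w} F (Fin 2 → ℝ)} {A B : Set (Fin 2 → ℝ)} {Ω : Set ProjPlane}

theorem weightedBottleneck_ofGraph (hM : M.PointwiseFinite) (hN : N.PointwiseFinite)
    (hA : IsCriticalSet M A) (hB : IsCriticalSet N B) (i : Fin 2) {μ : ℝ} (c : ℝ)
    (h0 : 0 < μ) (h1 : μ ≤ 1) :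
    weightedBottleneck M N (PosLine.ofGraph i c h0 h1) = fiberDist hA hB (graphHom i μ c) := by
  have h := fun x => PosLine.graphHom_eq (PosLine.ofGraph_m_left (i := i) (c := c) h0 h1) x
  rw [PosLine.ofGraph_m_right, PosLine.ofGraph_intercept] at h
  exact weightedBottleneck_eq_fiberDist hM hN hA hB _ _ _ h

theorem abs_sub_pushHom {L : PosLine} {h : (Fin 2 → ℝ) → ℝ} {κ : ℝ}
    (heq : ∀ x, h x = L.weight * L.pushParam x + κ) (x y : Fin 2 → ℝ) :
    |h x - h y| = L.weight * |L.pushParam x - L.pushParam y| := by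
  rw [heq, heq, add_sub_add_right_eq_sub, ← mul_sub, abs_mul, abs_of_pos L.weight_pos]

/-- Along a segment of lines on which no incidence with a point of `C ∪ Ω` changes, the weighted
bottleneck distance is bounded by its values at the ends. At an end the slope may be zero, where
`graphHom` no longer comes from a line. -/
theorem fiberDist_graphHom_le_max (hM : M.PointwiseFinite) (hN : N.PointwiseFinite)
    (hA : IsCriticalSet M A) (hB : IsCriticalSet N B)
    (hΩ : IsSwitchSet (supClosure A ∪ supClosure B) Ω) (i : Fin 2) (α β γ δ : ℝ) {a b t₀ : ℝ}
    (ha : a < t₀) (hb : t₀ < b)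
    (hμ : ∀ t ∈ Set.Ioo a b, 0 < α * t + β ∧ α * t + β ≤ 1)
    (hproper : ∀ u, properPoint u ∈ properPoint '' (supClosure A ∪ supClosure B) ∪ Ω →
      (∀ t ∈ Set.Ioo a b, (α * t + β) * u i + (γ * t + δ) ≠ u (1 - i)) ∨
      ∀ t ∈ Set.Ioo a b, (α * t + β) * u i + (γ * t + δ) = u (1 - i))
    (hinf : ∀ v hv, pointAtInfinity v hv ∈ Ω →
      (∀ t ∈ Set.Ioo a b, (α * t + β) * v i ≠ v (1 - i)) ∨
      ∀ t ∈ Set.Ioo a b, (α * t + β) * v i = v (1 - i)) :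
    fiberDist hA hB (graphHom i (α * t₀ + β) (γ * t₀ + δ)) ≤
      max (fiberDist hA hB (graphHom i (α * a + β) (γ * a + δ)))
        (fiberDist hA hB (graphHom i (α * b + β) (γ * b + δ))) := by
  have hab : a < b := ha.trans hb
  have ht₀ : t₀ ∈ Set.Ioo a b := ⟨ha, hb⟩
  have hclos : ∀ f g : ℝ → ℝ, Continuous f → Continuous g → (∀ t ∈ Set.Ioo a b, f t ≤ g t) →
      ∀ t ∈ Set.Icc a b, f t ≤ g t := by
    intro f g hf hg hfg t ht
    rw [← closure_Ioo hab.ne] at ht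
    exact closure_minimal (t := {t | f t ≤ g t}) hfg (isClosed_le hf hg) ht
  have hμ0 : ∀ t ∈ Set.Icc a b, 0 ≤ α * t + β :=
    hclos _ _ continuous_const (by fun_prop) fun t ht => (hμ t ht).1.le
  have hside : ∀ u, properPoint u ∈ properPoint '' (supClosure A ∪ supClosure B) ∪ Ω →
      ∀ t ∈ Set.Ioo a b, ∀ t' ∈ Set.Ioo a b,
      (u (1 - i) ≤ (α * t + β) * u i + (γ * t + δ) ↔
        u (1 - i) ≤ (α * t' + β) * u i + (γ * t' + δ)) ∧
      ((α * t + β) * u i + (γ * t + δ) ≤ u (1 - i) ↔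
        (α * t' + β) * u i + (γ * t' + δ) ≤ u (1 - i)) := fun u hu t ht t' ht' =>
    sides_iff_of_Ioo (f := fun t => (α * t + β) * u i + (γ * t + δ)) (g := fun _ => u (1 - i))
      (by fun_prop) (by fun_prop) (hproper u hu) ht ht'
  refine fiberDist_le_max hM hN hA hB (fun t => graphHom i (α * t + β) (γ * t + δ)) ha hb ?_ ?_
    (lam := (t₀ - a) / (b - a)) (div_nonneg (by linarith) (by linarith))
    ((div_le_one (by linarith)).2 (by linarith)) ?_
  · intro x _
    change Continuous fun t => max (max (α * t + β) 0 * x i + (γ * t + δ)) (x (1 - i))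
    fun_prop
  · intro t ht t' ht' x hx y hy z hz w hw d hd e he hle
    have hequiv : LineEquiv (properPoint '' (supClosure A ∪ supClosure B) ∪ Ω)
        (PosLine.ofGraph i (γ * t + δ) (hμ t ht).1 (hμ t ht).2)
        (PosLine.ofGraph i (γ * t' + δ) (hμ t' ht').1 (hμ t' ht').2) := by
      refine PosLine.lineEquiv_of_sides (PosLine.ofGraph_m_left _ _) (PosLine.ofGraph_m_left _ _)
        (fun u hu => ?_) fun v hv hvU => ?_
      · simp only [PosLine.ofGraph_m_right, PosLine.ofGraph_intercept]
        exact hside u hu t ht t' ht'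
      · simp only [PosLine.ofGraph_m_right]
        have hvΩ : pointAtInfinity v hv ∈ Ω := by
          rcases hvU with ⟨u, -, hu⟩ | h
          · exact absurd hu (properPoint_ne_pointAtInfinity _ _ _)
          · exact h
        exact sides_iff_of_Ioo (f := fun t => (α * t + β) * v i) (g := fun _ => v (1 - i))
          (by fun_prop) (by fun_prop) (hinf v hv hvΩ) ht ht'
    have hsign := hΩ.2 _ _ hequiv x hx y hy z hz w hw d hd e he
    have hcost : ∀ s (hs : s ∈ Set.Ioo a b),
        (|graphHom i (α * s + β) (γ * s + δ) x - graphHom i (α * s + β) (γ * s + δ) y| / d ≤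
          |graphHom i (α * s + β) (γ * s + δ) z - graphHom i (α * s + β) (γ * s + δ) w| / e ↔
        costDiff (PosLine.ofGraph i (γ * s + δ) (hμ s hs).1 (hμ s hs).2) x y z w d e ≤ 0) := by
      intro s hs
      have h := fun x => PosLine.graphHom_eq
        (PosLine.ofGraph_m_left (i := i) (c := γ * s + δ) (hμ s hs).1 (hμ s hs).2) x
      rw [PosLine.ofGraph_m_right, PosLine.ofGraph_intercept] at h
      rw [abs_sub_pushHom h, abs_sub_pushHom h, costDiff, sub_nonpos, mul_div_assoc, mul_div_assoc,
        mul_le_mul_iff_right₀ (PosLine.weight_pos _)]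
    rw [hcost t' ht', ← sign_nonpos_iff, ← hsign, sign_nonpos_iff, ← hcost t ht]
    exact hle
  · intro x hx
    have hxU : properPoint x ∈ properPoint '' (supClosure A ∪ supClosure B) ∪ Ω :=
      Or.inl ⟨x, hx, rfl⟩
    have ha' : a ∈ Set.Icc a b := ⟨le_rfl, hab.le⟩
    have hb' : b ∈ Set.Icc a b := ⟨hab.le, le_rfl⟩
    have ht' : t₀ ∈ Set.Icc a b := ⟨ha.le, hb.le⟩
    have hne : b - a ≠ 0 := by linarith
    rw [graphHom_apply (hμ0 _ ha'), graphHom_apply (hμ0 _ hb'), graphHom_apply (hμ0 _ ht')]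
    rcases le_total (x (1 - i)) ((α * t₀ + β) * x i + (γ * t₀ + δ)) with h | h
    · have h' := hclos (fun _ => x (1 - i)) (fun t => (α * t + β) * x i + (γ * t + δ))
        (by fun_prop) (by fun_prop) fun t ht => ((hside x hxU t₀ ht₀ t ht).1).1 h
      rw [max_eq_left (h' _ ha'), max_eq_left (h' _ hb'), max_eq_left (h' _ ht')]
      field_simp
      ring
    · have h' := hclos (fun t => (α * t + β) * x i + (γ * t + δ)) (fun _ => x (1 - i))
        (by fun_prop) (by fun_prop) fun t ht => ((hside x hxU t₀ ht₀ t ht).2).1 h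
      rw [max_eq_right (h' _ ha'), max_eq_right (h' _ hb'), max_eq_right (h' _ ht')]
      ring

/-- The proper points of `C ∪ Ω`. -/
def properPoints (C : Set (Fin 2 → ℝ)) (Ω : Set ProjPlane) : Set (Fin 2 → ℝ) :=
  {u | properPoint u ∈ properPoint '' C ∪ Ω}

/-- The slopes, over the coordinate `i`, of the points of positive direction of `Ω`. -/
def slopesAtInfinity (Ω : Set ProjPlane) (i : Fin 2) : Set ℝ :=
  {ρ | ∃ v hv, pointAtInfinity v hv ∈ Ω ∧ v (1 - i) / v i = ρ}

theorem properPoints_finite {C : Set (Fin 2 → ℝ)} (hC : C.Finite) (hΩ : Ω.Finite) :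
    (properPoints C Ω).Finite :=
  ((hC.image _).union hΩ).preimage properPoint_injective.injOn

theorem slopesAtInfinity_finite (hΩ : Ω.Finite) (i : Fin 2) : (slopesAtInfinity Ω i).Finite := by
  refine (hΩ.biUnion (t := fun p => {ρ | ∃ v hv, pointAtInfinity v hv = p ∧ v (1 - i) / v i = ρ})
    fun p _ => Set.Subsingleton.finite ?_).subset ?_
  · rintro _ ⟨v, hv, hp, rfl⟩ _ ⟨v', hv', hp', rfl⟩
    obtain ⟨a, ha, hav⟩ := (pointAtInfinity_eq_iff hv hv').1 (hp.trans hp'.symm)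
    rw [hav, hav, mul_div_mul_left _ _ ha.ne']
  · rintro ρ ⟨v, hv, hvΩ, hρ⟩
    exact Set.mem_biUnion hvΩ ⟨v, hv, rfl, hρ⟩

/-- The slopes over the coordinate `i` of the lines through a proper point and a further point: the
diagonal direction, the directions in `Ω`, and the slopes of lines through two proper points. -/
def specialSlopes (C : Set (Fin 2 → ℝ)) (Ω : Set ProjPlane) (i : Fin 2) (w : Fin 2 → ℝ) : Set ℝ :=
  insert 1 (slopesAtInfinity Ω i ∪
    (fun u => (u (1 - i) - w (1 - i)) / (u i - w i)) '' properPoints C Ω)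

theorem specialSlopes_finite {C : Set (Fin 2 → ℝ)} (hC : C.Finite) (hΩ : Ω.Finite) (i : Fin 2)
    (w : Fin 2 → ℝ) : (specialSlopes C Ω i w).Finite :=
  ((slopesAtInfinity_finite hΩ i).union ((properPoints_finite hC hΩ).image _)).insert _

/-- Translating a line until it meets a proper point does not decrease the weighted bottleneck
distance for one of the two directions. -/
theorem exists_translate (hM : M.PointwiseFinite) (hN : N.PointwiseFinite)
    (hA : IsCriticalSet M A) (hB : IsCriticalSet N B)
    (hΩ : IsSwitchSet (supClosure A ∪ supClosure B) Ω)
    (hne : (supClosure A ∪ supClosure B).Nonempty) (i : Fin 2) {μ : ℝ} (c : ℝ)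
    (h0 : 0 < μ) (h1 : μ ≤ 1) :
    ∃ w ∈ properPoints (supClosure A ∪ supClosure B) Ω,
      fiberDist hA hB (graphHom i μ c) ≤
        fiberDist hA hB (graphHom i μ (w (1 - i) - μ * w i)) := by
  set X := properPoints (supClosure A ∪ supClosure B) Ω with hX
  have hCX : supClosure A ∪ supClosure B ⊆ X := fun x hx => Or.inl ⟨x, hx, rfl⟩
  have hXfin : X.Finite := properPoints_finite (hA.1.supClosure.union hB.1.supClosure) hΩ.1
  let q : (Fin 2 → ℝ) → ℝ := fun u => u (1 - i) - μ * u i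
  by_cases hc : ∃ w ∈ X, q w = c
  · obtain ⟨w, hw, rfl⟩ := hc
    exact ⟨w, hw, le_rfl⟩
  push Not at hc
  by_cases hlt : ({u ∈ X | q u < c}).Nonempty
  · obtain ⟨w, ⟨hw, hwc⟩, hwmax⟩ :=
      (hXfin.subset (Set.sep_subset X fun u => q u < c)).exists_maximalFor q _ hlt
    by_cases hgt : ({u ∈ X | c < q u}).Nonempty
    · obtain ⟨w', ⟨hw', hwc'⟩, hwmin⟩ :=
        (hXfin.subset (Set.sep_subset X fun u => c < q u)).exists_minimalFor q _ hgt
      have := fiberDist_graphHom_le_max hM hN hA hB hΩ i 0 μ 1 0 hwc hwc'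
        (fun t _ => by rw [zero_mul, zero_add]; exact ⟨h0, h1⟩) ?_ ?_
      · simp only [zero_mul, zero_add, one_mul, add_zero] at this
        rcases le_max_iff.1 this with h | h
        · exact ⟨w, hw, h⟩
        · exact ⟨w', hw', h⟩
      · refine fun u hu => Or.inl fun t ht h => ?_
        have ht' : q u = t := by simp only [q]; linarith
        rcases lt_trichotomy (q u) c with h | h | h
        · have := hwmax ⟨hu, h⟩
          have h2 := ht.1
          rw [← ht'] at h2
          exact absurd (this h2.le) (not_le.2 h2)
        · exact hc u hu h
        · have := hwmin ⟨hu, h⟩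
          have h2 := ht.2
          rw [← ht'] at h2
          exact absurd (this h2.le) (not_le.2 h2)
      · intro v _ _
        by_cases h : μ * v i = v (1 - i)
        · exact Or.inr fun t _ => by rw [zero_mul, zero_add, h]
        · exact Or.inl fun t _ => by rwa [zero_mul, zero_add]
    · -- all points lie below the line, so that the pushes are translated with it
      refine ⟨w, hw, (fiberDist_eq_of_add hM hN hA hB (c - q w) fun x hx => ?_).le⟩
      have hxc : q x < c := by
        refine lt_of_le_of_ne (not_lt.1 fun h => hgt ⟨x, hCX hx, h⟩) (hc x (hCX hx))
      have hxw : q x ≤ q w := by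
        rcases le_total (q x) (q w) with h | h
        · exact h
        · exact hwmax ⟨hCX hx, hxc⟩ h
      simp only [q] at hxc hxw
      rw [graphHom_apply h0.le, graphHom_apply h0.le, max_eq_left (by linarith),
        max_eq_left (by linarith)]
      simp only [q]
      ring
  · -- all points lie above the line, so that the pushes do not depend on it
    have hgt : ∀ x ∈ X, c < q x := fun x hx =>
      lt_of_le_of_ne (not_lt.1 fun h => hlt ⟨x, hx, h⟩) (hc x hx).symm
    obtain ⟨w, hw, hwmin⟩ := hXfin.exists_minimalFor q _ (hne.mono hCX)
    refine ⟨w, hw, (fiberDist_eq_of_add hM hN hA hB 0 fun x hx => ?_).le⟩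
    have hxc := hgt x (hCX hx)
    have hxw : q w ≤ q x := by
      rcases le_total (q w) (q x) with h | h
      · exact h
      · exact hwmin (hCX hx) h
    simp only [q] at hxc hxw
    rw [graphHom_apply h0.le, graphHom_apply h0.le, max_eq_right (by linarith),
      max_eq_right (by linarith), add_zero]

/-- Rotating a line about a proper point until its slope becomes special does not decrease the
weighted bottleneck distance for one of the two directions. If the slope tends to zero in the
process, the limit is a clamped version of the situation on a diagonal line below all points. -/
theorem exists_rotate (hM : M.PointwiseFinite) (hN : N.PointwiseFinite)
    (hA : IsCriticalSet M A) (hB : IsCriticalSet N B)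
    (hΩ : IsSwitchSet (supClosure A ∪ supClosure B) Ω) (i : Fin 2) {μ : ℝ} (h0 : 0 < μ)
    (h1 : μ ≤ 1) {w : Fin 2 → ℝ} (hw : w ∈ properPoints (supClosure A ∪ supClosure B) Ω) :
    ∃ w' ∈ properPoints (supClosure A ∪ supClosure B) Ω,
      ∃ ρ ∈ specialSlopes (supClosure A ∪ supClosure B) Ω i w', 0 < ρ ∧ ρ ≤ 1 ∧
        fiberDist hA hB (graphHom i μ (w (1 - i) - μ * w i)) ≤
          fiberDist hA hB (graphHom i ρ (w' (1 - i) - ρ * w' i)) := by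
  set X := properPoints (supClosure A ∪ supClosure B) Ω with hX
  have hCX : supClosure A ∪ supClosure B ⊆ X := fun x hx => Or.inl ⟨x, hx, rfl⟩
  have hCfin := hA.1.supClosure.union hB.1.supClosure
  have hXfin : X.Finite := properPoints_finite hCfin hΩ.1
  set Z := specialSlopes (supClosure A ∪ supClosure B) Ω i w with hZ
  have hZfin : Z.Finite := specialSlopes_finite hCfin hΩ.1 i w
  by_cases hμZ : μ ∈ Z
  · exact ⟨w, hw, μ, hμZ, h0, h1, le_rfl⟩
  have h1Z : (1 : ℝ) ∈ Z := Set.mem_insert _ _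
  have hlt1 : μ < 1 := lt_of_le_of_ne h1 fun h => hμZ (h ▸ h1Z)
  obtain ⟨b, ⟨hbZ, hμb⟩, hbmin⟩ := Set.exists_min_image {z ∈ Z | μ < z} id
    (hZfin.subset (Set.sep_subset _ _)) ⟨1, h1Z, hlt1⟩
  obtain ⟨a, ⟨haZ, haμ⟩, hamax⟩ := Set.exists_max_image {z ∈ insert 0 Z | z < μ} id
    ((hZfin.insert 0).subset (Set.sep_subset _ _)) ⟨0, Set.mem_insert _ _, h0⟩
  simp only [id] at hbmin hamax
  have hb1 : b ≤ 1 := hbmin 1 ⟨h1Z, hlt1⟩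
  have ha0 : 0 ≤ a := hamax 0 ⟨Set.mem_insert _ _, h0⟩
  have hgap : ∀ t ∈ Set.Ioo a b, t ∉ Z := by
    intro t ht htZ
    rcases lt_trichotomy t μ with h | rfl | h
    · exact absurd (hamax t ⟨Or.inr htZ, h⟩) (not_le.2 ht.1)
    · exact hμZ htZ
    · exact absurd (hbmin t ⟨htZ, h⟩) (not_le.2 ht.2)
  have key := fiberDist_graphHom_le_max hM hN hA hB hΩ i 1 0 (-w i) (w (1 - i)) haμ hμb
    (fun t ht => by
      rw [one_mul, add_zero]
      exact ⟨ha0.trans_lt ht.1, (ht.2.le).trans hb1⟩) ?_ ?_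
  · have hform : ∀ t, -w i * t + w (1 - i) = w (1 - i) - t * w i := fun t => by ring
    simp only [one_mul, add_zero, hform] at key
    rcases le_max_iff.1 key with h | h
    · rcases ha0.eq_or_lt with rfl | hapos
      · -- the limit of slope zero is a clamped version of the lowest line of slope one through a
        -- proper point
        obtain ⟨w', hw', hmin⟩ := hXfin.exists_minimalFor (fun u => u (1 - i) - u i) _ ⟨w, hw⟩
        refine ⟨w', hw', 1, Set.mem_insert _ _, one_pos, le_rfl, h.trans ?_⟩
        have hh : ∀ x, graphHom i 0 (w (1 - i) - 0 * w i) x = max (w (1 - i)) (x (1 - i)) :=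
          fun x => by rw [graphHom_apply le_rfl]; simp
        have hh' : ∀ x ∈ supClosure A ∪ supClosure B,
            graphHom i 1 (w' (1 - i) - 1 * w' i) x = x (1 - i) := by
          intro x hx
          rw [graphHom_apply zero_le_one, max_eq_right]
          rcases le_total (w' (1 - i) - w' i) (x (1 - i) - x i) with h | h
          · linarith
          · have : w' (1 - i) - w' i ≤ x (1 - i) - x i := hmin (hCX hx) h
            linarith
        rw [← one_mul (fiberDist hA hB (graphHom i 1 _)), ← ENNReal.ofReal_one]
        refine fiberDist_le hM hN hA hB one_pos (fun x hx y hy hxy => ?_) fun x hx y hy => ?_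
        · rw [hh' x hx, hh' y hy] at hxy
          rw [hh, hh]
          exact max_le_max le_rfl hxy
        · rw [hh, hh, hh' x hx, hh' y hy, one_mul, max_comm, max_comm (w (1 - i))]
          exact abs_max_sub_max_le_abs _ _ _
      · exact ⟨w, hw, a, haZ.resolve_left hapos.ne', hapos, haμ.le.trans h1, h⟩
    · exact ⟨w, hw, b, hbZ, h0.trans hμb, hb1, h⟩
  · intro u hu
    by_cases huw : u = w
    · subst huw
      exact Or.inr fun t _ => by ring
    · refine Or.inl fun t ht h => ?_
      by_cases hi : u i = w i
      · refine huw (funext ((Fin.forall_fin_two_sub i).2 ⟨hi, ?_⟩))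
        rw [hi] at h
        linarith
      · refine hgap t ht (Or.inr (Or.inr ⟨u, hu, ?_⟩))
        have : u i - w i ≠ 0 := sub_ne_zero.2 hi
        simp only
        rw [div_eq_iff this]
        linarith
  · intro v hv hvΩ
    refine Or.inl fun t ht h => hgap t ht (Or.inr (Or.inl ⟨v, hv, hvΩ, ?_⟩))
    rw [div_eq_iff (hv i).ne']
    linarith

/-- A line of special slope through a proper point contains two of the points in question. -/
theorem exists_two_points {C : Set (Fin 2 → ℝ)} {i : Fin 2} {w : Fin 2 → ℝ}
    (hw : w ∈ properPoints C Ω) {ρ : ℝ} (hρ : ρ ∈ specialSlopes C Ω i w) (h0 : 0 < ρ)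
    (h1 : ρ ≤ 1) :
    ∃ p ∈ properPoint '' C ∪ (Ω ∪ {diagonalPoint}),
      ∃ q ∈ properPoint '' C ∪ (Ω ∪ {diagonalPoint}), p ≠ q ∧
        p ∈ (PosLine.ofGraph i (w (1 - i) - ρ * w i) h0 h1).projPoints ∧
        q ∈ (PosLine.ofGraph i (w (1 - i) - ρ * w i) h0 h1).projPoints := by
  set L := PosLine.ofGraph i (w (1 - i) - ρ * w i) h0 h1 with hL
  have hm : L.m i = 1 := PosLine.ofGraph_m_left h0 h1
  have hm' : L.m (1 - i) = ρ := PosLine.ofGraph_m_right h0 h1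
  have hc : L.intercept i = w (1 - i) - ρ * w i := PosLine.ofGraph_intercept h0 h1
  have hX : ∀ u ∈ properPoints C Ω, properPoint u ∈ properPoint '' C ∪ (Ω ∪ {diagonalPoint}) :=
    fun u hu => hu.imp_right Or.inl
  have hon : ∀ u : Fin 2 → ℝ, u (1 - i) - w (1 - i) = ρ * (u i - w i) →
      properPoint u ∈ L.projPoints := by
    intro u hu
    obtain ⟨s, rfl⟩ := PosLine.exists_point_eq hm (u := u) (by rw [hm', hc]; linarith)
    exact Or.inr ⟨s, rfl⟩
  have hinf : ∀ v hv, v (1 - i) = ρ * v i → pointAtInfinity v hv ∈ L.projPoints := by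
    intro v hv hvρ
    refine Or.inl ((pointAtInfinity_eq_iff hv L.m_pos).2 ⟨v i, hv i, ?_⟩)
    refine (Fin.forall_fin_two_sub i).2 ⟨by rw [hm, mul_one], ?_⟩
    rw [hm', hvρ, mul_comm]
  rcases hρ with rfl | ⟨v, hv, hvΩ, hvρ⟩ | ⟨u, hu, huρ⟩
  · exact ⟨_, hX w hw, diagonalPoint, Or.inr (Or.inr rfl), properPoint_ne_pointAtInfinity _ _ _,
      hon w (by ring), hinf _ _ (by simp)⟩
  · exact ⟨_, hX w hw, _, Or.inr (Or.inl hvΩ), properPoint_ne_pointAtInfinity _ _ _,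
      hon w (by ring), hinf v hv (by rw [← hvρ, div_mul_cancel₀ _ (hv i).ne'])⟩
  · have hne : u i - w i ≠ 0 := by
      intro h
      simp only [h, div_zero] at huρ
      exact h0.ne huρ
    refine ⟨_, hX w hw, _, hX u hu, fun h => hne ?_, hon w (by ring), hon u ?_⟩
    · rw [properPoint_injective h, sub_self]
    · rw [← huρ, div_mul_cancel₀ _ hne]

end Moves

/-! ### Trivial modules and the theorem -/

theorem PersistenceModule.IsTrivial.dgm_eq_zero {F : Type u} [Field F]
    {V : PersistenceModule.{u, v} F ℝ} (hV : V.IsTrivial) : dgm V = 0 := by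
  have key : ∀ D, IsDiagramOf V D → D = 0 := by
    intro D hD
    refine Multiset.eq_zero_of_forall_notMem fun I hI => ?_
    have h := hD.countP_eq (le_refl I.birth)
    have := hV I.birth
    rw [Module.finrank_zero_of_subsingleton, Multiset.countP_eq_zero] at h
    exact h I hI ⟨le_rfl, I.lt⟩
  rw [dgm]
  split_ifs with h
  · exact key _ h.choose_spec
  · rfl

theorem bottleneckDist_zero_zero : bottleneckDist 0 0 = 0 := by
  refine le_antisymm ((iInf_le _ ⟨0, 0, 0, by simp, by simp⟩).trans ?_) zero_le
  simp [BarMatching.cost]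

theorem IsCriticalSet.isTrivial {F : Type u} [Field F]
    {M : PersistenceModule.{u, v} F (Fin 2 → ℝ)} {C : Set (Fin 2 → ℝ)} (hC : IsCriticalSet M C)
    (h : ¬ (supClosure C).Nonempty) : M.IsTrivial := fun _ =>
  hC.subsingleton fun z hz => absurd ⟨z, hz⟩ h

end

theorem theorem3p1 {F : Type u} [Field F]
    (M : PersistenceModule.{u, v} F (Fin 2 → ℝ)) (N : PersistenceModule.{u, w} F (Fin 2 → ℝ))
    (hM : M.PointwiseFinite) (hN : N.PointwiseFinite) :
    (M.IsTrivial → N.IsTrivial → matchingDist M N = 0) ∧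
    (¬ (M.IsTrivial ∧ N.IsTrivial) →
      ∀ (C_M C_N : Set (Fin 2 → ℝ)) (Ω : Set ProjPlane),
        IsCriticalSet M C_M → IsCriticalSet N C_N →
        IsSwitchSet (supClosure C_M ∪ supClosure C_N) Ω →
        ∃ L : PosLine,
          (∃ p ∈ properPoint '' (supClosure C_M ∪ supClosure C_N) ∪ (Ω ∪ {diagonalPoint}),
            ∃ q ∈ properPoint '' (supClosure C_M ∪ supClosure C_N) ∪ (Ω ∪ {diagonalPoint}),
              p ≠ q ∧ p ∈ L.projPoints ∧ q ∈ L.projPoints) ∧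
          weightedBottleneck M N L = matchingDist M N) := by
  constructor
  · intro hMt hNt
    refine le_antisymm (iSup_le fun L => le_of_eq ?_) zero_le
    have h1 : dgm (M.restrict L) = 0 :=
      PersistenceModule.IsTrivial.dgm_eq_zero fun s => hMt (L.point s)
    have h2 : dgm (N.restrict L) = 0 :=
      PersistenceModule.IsTrivial.dgm_eq_zero fun s => hNt (L.point s)
    rw [weightedBottleneck, h1, h2, bottleneckDist_zero_zero, mul_zero]
  intro hnt A B Ω hA hB hΩ
  have hne : (supClosure A ∪ supClosure B).Nonempty := by
    by_contra h
    rw [Set.union_nonempty, not_or] at h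
    exact hnt ⟨hA.isTrivial h.1, hB.isTrivial h.2⟩
  set C := supClosure A ∪ supClosure B with hC
  have hCfin : C.Finite := hA.1.supClosure.union hB.1.supClosure
  -- the finitely many candidates, as triples of a coordinate, a slope and a proper point
  let T : Set (Fin 2 × ℝ × (Fin 2 → ℝ)) :=
    {x | x.2.2 ∈ properPoints C Ω ∧ x.2.1 ∈ specialSlopes C Ω x.1 x.2.2 ∧ 0 < x.2.1 ∧ x.2.1 ≤ 1}
  have hTfin : T.Finite := by
    have hfin : (⋃ i : Fin 2, ⋃ w ∈ properPoints C Ω,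
        (fun ρ => ((i, ρ, w) : Fin 2 × ℝ × (Fin 2 → ℝ))) '' specialSlopes C Ω i w).Finite :=
      Set.finite_iUnion fun i => (properPoints_finite hCfin hΩ.1).biUnion fun w _ =>
        (specialSlopes_finite hCfin hΩ.1 i w).image _
    refine hfin.subset ?_
    rintro ⟨i, ρ, w⟩ ⟨hw, hρ, -⟩
    exact Set.mem_iUnion.2 ⟨i, Set.mem_biUnion hw ⟨ρ, hρ, rfl⟩⟩
  let g : Fin 2 × ℝ × (Fin 2 → ℝ) → ℝ≥0∞ := fun x =>
    fiberDist hA hB (graphHom x.1 x.2.1 (x.2.2 (1 - x.1) - x.2.1 * x.2.2 x.1))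
  have hdom : ∀ L : PosLine, ∃ x ∈ T, weightedBottleneck M N L ≤ g x := by
    intro L
    obtain ⟨i, hi, hle⟩ := L.exists_m_eq_one
    rw [weightedBottleneck_eq_fiberDist hM hN hA hB L _ _ (PosLine.graphHom_eq hi)]
    obtain ⟨w, hw, h⟩ := exists_translate hM hN hA hB hΩ hne i (L.intercept i)
      (L.m_pos (1 - i)) hle
    obtain ⟨w', hw', ρ, hρ, h0, h1, h'⟩ := exists_rotate hM hN hA hB hΩ i
      (L.m_pos (1 - i)) hle hw
    exact ⟨(i, ρ, w'), ⟨hw', hρ, h0, h1⟩, h.trans h'⟩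
  obtain ⟨y, hy, -⟩ := hdom (PosLine.ofGraph 0 0 one_pos le_rfl)
  obtain ⟨⟨i, ρ, w⟩, ⟨hw, hρ, h0, h1⟩, hmax⟩ := Set.exists_max_image T g hTfin ⟨y, hy⟩
  refine ⟨PosLine.ofGraph i (w (1 - i) - ρ * w i) h0 h1, exists_two_points hw hρ h0 h1, ?_⟩
  refine le_antisymm (le_iSup (weightedBottleneck M N) _) (iSup_le fun L => ?_)
  obtain ⟨x, hx, h⟩ := hdom L
  rw [weightedBottleneck_ofGraph hM hN hA hB]
  exact h.trans (hmax x hx)
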